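/- **Setting.** Let $\epsilon\in(0,1/4]$ with $1/\epsilon$ an integer, and let $I_L$ be a finite set of items $i$ with widths $w(i)\in[\epsilon,1]$ and heights $h(i)\in(0,1]$. Put $\mathrm{SIZE}(I_L)=\sum_i w(i)h(i)$, $h_B=13/\epsilon^2$, $\omega=\lfloor\log_2(1/\epsilon)\rfloor+1$ and $k=\lfloor \frac{\epsilon}{4\omega h_B}\mathrm{SIZE}(I_L)\rfloor$, and assume $\mathrm{SIZE}(I_L)\ge\frac{4\omega h_B}{\epsilon}(h_B+1)$. Let $con$ assign the items to finitely many containers such that no container receives items of total height more than $h_B$, and let $R$ map containers to groups $(l,X,r)$ with $l,r\in\mathbb N$, $X\in\{A,B\}$. Write $K_g$ for the number of containers in group $g$, $h(g)$ for the total height of the items in the containers of $g$, and $q(l,X)$ for the largest $r$ such that $(l,X,r)$ contains a container. The group to the left of $(l,X,r)$ is $(l,X,r-1)$ if $r>0$, and the group to the left of $(l,B,0)$ is $(l,A,q(l,A))$. The width of a container is the width of its widest item. Let $W$ be the set of those $l$ for which some container has width in $(2^{-(l+1)},2^{-l}]$. Assume the invariant properties: 1. $2^{-(l+1)}<w(i)\le2^{-l}$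 for every item $i$ in a group $(l,\cdot,\cdot)$; 2. $w(i)\ge w(i')$ whenever the group of $i$ is to the left of the group of $i'$; 3. $K_{(l,A,0)}\le2^lk$, and $K_{(l,A,r)}=2^lk$ for $l\in W$, $1\le r\le q(l,A)$; 4. $K_{(l,B,q(l,B))}\le2^l(k-1)$, and $K_{(l,B,r)}=2^l(k-1)$ for $l\in W$, $0\le r<q(l,B)$; 5. $(h_B-1)(K_g-1)\le h(g)\le(h_B-1)K_g$ for every group $g$. The rounded container instance $C$ consists of all non-empty containers, each with its width rounded up to the largest width of a container in its group. Let $w_1,\dots,w_m$ be the distinct widths in $C$, and $b_j$ the number of containers of width $w_j$. A pattern is a multiset of these widths with sum at most $1$; let $P_1,\dots,P_n$ be the patterns and $a(P_i,j)$ the multiplicity of $w_j$ in $P_i$. The LP for $C$ is $\min\|x\|$ subject to $\sum_i x_i\,a(P_i,j)\ge b_j$ for all $j$ and $x\ge0$, where $\|\cdot\|$ is the $\ell^1$ norm. Its optimal value is $\mathrm{LIN}(C)$, and its optimal value over integral vectors is $\mathrm{OPT}(C)$, the minimum number of levels. Let $\mathrm{OPT}(I_L)$ be the minimum height of a packing of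 $I_L$ into a strip of width $1$ (without rotation), measured in a unit $u$, where either $u=1$ (the strip width) or $u=h_B$ (the height of a level). Let $\mathrm{nnz}(x)$ be the number of non-zero components of $x$. **Algorithm Improve.** With parameter $\delta>0$, $\mathrm{Improve}(\alpha)$ on $x,y$ does the following. Put $v=2\alpha(\frac1\delta+1)$ and $\rho=\frac\delta2$ if $2\alpha(\frac1\delta+1)<\|x\|$, and $v=\alpha(\frac1\delta+1)$ and $\rho=0$ otherwise. Let $x^{fix}=(1-v/\|x\|)x$, and compute a solution $\hat x$ of the LP with right hand side $b-Ax^{fix}$ whose norm is at most $1+\rho$ times the optimum of that LP. - If $\|x^{fix}+\hat x\|\ge\|x\|$, put $x'=x$ and $\hat y=y$. - Otherwise let $S$ be a set of the $\ell$ smallest non-zero components of $y$, with $\ell$ maximal such that their sum is at most $(m+2)(\frac1\delta+2)$. Replace $\hat x+x^{fix}|_S$ by a vector $r\ge0$ with at most $m+1$ non-zero components, with $\|r\|\le\|\hat x+x^{fix}|_S\|$ and $Ar\ge A(\hat x+x^{fix}|_S)$. Put $x'=x^{fix}|_{S^c}+r$ and $\hat y=\max(\lceil x'\rceil,\,y|_{S^c})$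 (componentwise). Finally choose an integral $y'$ with $\lceil x'\rceil\le y'\le\hat y$ and $\|y'\|=\max(\|\lceil x'\rceil\|,\min(\|\hat y\|,\|y\|-\alpha))$, and return $x',y'$. **Theorem.** There are absolute constants $C_0,C_1>0$ such that in this setting $\mathrm{OPT}(C)\le(1+4\epsilon)\mathrm{OPT}(I_L)+C_0/\epsilon^4$, and the following holds for every $z\ge C_0/\epsilon^4$. Let $\delta,\delta'>0$, $\alpha\in\mathbb N$ (with $0 \in \mathbb N$), $\Delta=(1+4\epsilon)(1+\delta)-1$ and $D=\Delta\,\mathrm{OPT}(I_L)+m+(1+\delta)z$. Let $x$ be a fractional solution of the LP for $C$ with $$\|x\|\le(1+\Delta)\mathrm{OPT}(I_L)+(1+\delta)z,\qquad \|x\|\ge2\alpha(\tfrac1\delta+1),\qquad \|x\|=(1+\delta')\mathrm{LIN}(C),$$ and let $y$ be an integral solution with $$\|y\|\ge(m+2)(\tfrac1\delta+2),\qquad \|y\|\le(1+2\Delta)\mathrm{OPT}(I_L)+2(1+\delta)z+m.$$ Let further $\mathrm{nnz}(x)=\mathrm{nnz}(y)\le D$ and $x_i\le y_i$ for all $i$.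 Then $\mathrm{Improve}(\alpha)$ on $x,y$ has an output, and every output $x',y'$ (for all choices left open in the algorithm) consists of a fractional solution $x'$ with $\|x'\|\le(1+\Delta)\mathrm{OPT}(I_L)+(1+\delta)z-\alpha$ and an integral solution $y'$ with $\|y'\|\le(1+2\Delta)\mathrm{OPT}(I_L)+2(1+\delta)z+m-\alpha$, such that $\mathrm{nnz}(x')=\mathrm{nnz}(y')\le D$ and $x'_i\le y'_i$ for all $i$. The number $\|y'-y\|$ of levels that are opened or closed is at most $C_1(m+\alpha)(1+\frac1\delta)$; for bounded $\alpha$ and $\delta\le1$ this is $O(m/\delta)$. -/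

import Mathlib

namespace StripPacking

noncomputable section

/-! ### Items and strip packing -/

/-- A strip packing instance of big and flat items: all widths lie in `[ε, 1]`, all heights in
`(0, 1]`. The items are the elements of `ι`. -/
structure LargeInstance (ε : ℝ) (ι : Type*) where
  w : ι → ℝ
  h : ι → ℝ
  le_w : ∀ i, ε ≤ w i
  w_le : ∀ i, w i ≤ 1
  h_pos : ∀ i, 0 < h i
  h_le : ∀ i, h i ≤ 1

/-- The total area of the items. -/
def LargeInstance.size {ε : ℝ} {ι : Type*} [Fintype ι] (I : LargeInstance ε ι) : ℝ :=
  ∑ i, I.w i * I.h i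

/-- `p i` is the lower left corner of item `i`. The items lie in the strip of width `1`, between
height `0` and height `H`, without rotation, and their interiors are pairwise disjoint. -/
def LargeInstance.IsPacking {ε : ℝ} {ι : Type*} (I : LargeInstance ε ι) (H : ℝ)
    (p : ι → ℝ × ℝ) : Prop :=
  (∀ i, 0 ≤ (p i).1 ∧ (p i).1 + I.w i ≤ 1 ∧ 0 ≤ (p i).2 ∧ (p i).2 + I.h i ≤ H) ∧
  ∀ i j, i ≠ j →
    (p i).1 + I.w i ≤ (p j).1 ∨ (p j).1 + I.w j ≤ (p i).1 ∨
    (p i).2 + I.h i ≤ (p j).2 ∨ (p j).2 + I.h j ≤ (p i).2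

/-- The minimum height of a strip packing. -/
def LargeInstance.opt {ε : ℝ} {ι : Type*} (I : LargeInstance ε ι) : ℝ :=
  sInf {H : ℝ | 0 ≤ H ∧ ∃ p, I.IsPacking H p}

/-! ### Parameters -/

/-- The container height `13 / ε ^ 2`. -/
def containerHeight (ε : ℝ) : ℝ := 13 / ε ^ 2

/-- The bound `⌊log₂ (1 / ε)⌋ + 1` on the number of width categories. -/
def numCategories (ε : ℝ) : ℕ := ⌊Real.logb 2 (1 / ε)⌋₊ + 1

/-- The parameter `k` of the invariant properties. -/
def blockParam {ε : ℝ} {ι : Type*} [Fintype ι] (I : LargeInstance ε ι) : ℕ :=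
  ⌊ε / (4 * numCategories ε * containerHeight ε) * I.size⌋₊

/-! ### Containers, groups and rounding -/

/-- The two blocks of a width category. -/
inductive Block
  | A
  | B

/-- A group `(l, X, r)`: category, block, position in the block. -/
structure WidthGroup where
  cat : ℕ
  block : Block
  pos : ℕ

section Containers

variable {ε : ℝ} {ι κ : Type*} [Fintype ι] [Fintype κ]

open scoped Classical in
/-- `con` assigns items to containers; no container gets items of total height more than the
container height. -/
def IsContainerAssignment (I : LargeInstance ε ι) (con : ι → κ) : Prop :=
  ∀ c, ∑ i ∈ Finset.univ.filter (fun i => con i = c), I.h i ≤ containerHeight ε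

/-- The width of a container: the width of its widest item (and `0` if it is empty). -/
def containerWidth (I : LargeInstance ε ι) (con : ι → κ) (c : κ) : ℝ :=
  ⨆ i : {i : ι // con i = c}, I.w i

/-- The rounded width of a container: the width of the widest container in its group. -/
def roundedWidth (I : LargeInstance ε ι) (con : ι → κ) (R : κ → WidthGroup) (c : κ) : ℝ :=
  ⨆ c' : {c' : κ // R c' = R c}, containerWidth I con c'

open scoped Classical in
/-- The rounded container instance, as the multiset of the rounded widths of all non-empty
containers. (All containers have the same height.) -/
def roundedInstance (I : LargeInstance ε ι) (con : ι → κ) (R : κ → WidthGroup) : Multiset ℝ :=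
  (Finset.univ.image con).val.map (roundedWidth I con R)

/-- The set `W` of non-empty width categories. -/
def IsCategory (I : LargeInstance ε ι) (con : ι → κ) (l : ℕ) : Prop :=
  ∃ c : κ, (1 / 2 : ℝ) ^ (l + 1) < containerWidth I con c ∧
    containerWidth I con c ≤ (1 / 2 : ℝ) ^ l

/-- The number `K_g` of containers in group `g`. -/
def groupCard (R : κ → WidthGroup) (g : WidthGroup) : ℕ :=
  Nat.card {c : κ // R c = g}

open scoped Classical in
/-- The total height `h(g)` of the items in group `g`. -/
def groupHeight (I : LargeInstance ε ι) (con : ι → κ) (R : κ → WidthGroup) (g : WidthGroup) : ℝ :=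
  ∑ i ∈ Finset.univ.filter (fun i => R (con i) = g), I.h i

/-- `q` is the maximum position of a non-empty group in block `X` of category `l`. -/
def IsLastPos (R : κ → WidthGroup) (l : ℕ) (X : Block) (q : ℕ) : Prop :=
  (∃ c, R c = ⟨l, X, q⟩) ∧ ∀ r, (∃ c, R c = ⟨l, X, r⟩) → r ≤ q

/-- `g` is the group to the left of `g'`. (The group left of `(l, A, 0)` is always empty, and so
is the group left of `(l, B, 0)` if block `A` of category `l` is empty; they are left out.) -/
def IsLeftOf (R : κ → WidthGroup) (g g' : WidthGroup) : Prop :=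
  g.cat = g'.cat ∧
    ((g.block = g'.block ∧ g.pos + 1 = g'.pos) ∨
      (g'.block = Block.B ∧ g'.pos = 0 ∧ g.block = Block.A ∧ IsLastPos R g.cat Block.A g.pos))

/-- The invariant properties of a container assignment and a rounding function. -/
structure Invariant (I : LargeInstance ε ι) (con : ι → κ) (R : κ → WidthGroup) : Prop where
  /-- every item is in a group of its width category -/
  categories : ∀ i, (1 / 2 : ℝ) ^ ((R (con i)).cat + 1) < I.w i ∧
    I.w i ≤ (1 / 2 : ℝ) ^ (R (con i)).cat
  /-- the items are sorted over the groups -/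
  sorting : ∀ i i', IsLeftOf R (R (con i)) (R (con i')) → I.w i' ≤ I.w i
  /-- number of containers in the first group of block `A` -/
  blockA_first : ∀ l, IsCategory I con l →
    groupCard R ⟨l, Block.A, 0⟩ ≤ 2 ^ l * blockParam I
  /-- number of containers in the other groups of block `A` -/
  blockA : ∀ l, IsCategory I con l → ∀ q, IsLastPos R l Block.A q → ∀ r, 1 ≤ r → r ≤ q →
    groupCard R ⟨l, Block.A, r⟩ = 2 ^ l * blockParam I
  /-- number of containers in the last group of block `B` -/
  blockB_last : ∀ l, IsCategory I con l → ∀ q, IsLastPos R l Block.B q →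
    (groupCard R ⟨l, Block.B, q⟩ : ℝ) ≤ 2 ^ l * ((blockParam I : ℝ) - 1)
  /-- number of containers in the other groups of block `B` -/
  blockB : ∀ l, IsCategory I con l → ∀ q, IsLastPos R l Block.B q → ∀ r, r < q →
    (groupCard R ⟨l, Block.B, r⟩ : ℝ) = 2 ^ l * ((blockParam I : ℝ) - 1)
  /-- total height of the items per group -/
  height : ∀ g,
    (containerHeight ε - 1) * ((groupCard R g : ℝ) - 1) ≤ groupHeight I con R g ∧
    groupHeight I con R g ≤ (containerHeight ε - 1) * groupCard R g

end Containers

/-! ### The configuration LP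

A container instance is given by the multiset `C` of the widths of its containers. -/

/-- A pattern is a multiset of widths of `C` that fits into one level of the strip. -/
abbrev Pattern (C : Multiset ℝ) : Type :=
  {P : Multiset ℝ // (∀ w ∈ P, w ∈ C) ∧ P.sum ≤ 1}

/-- The number `m` of constraints: one for each width that occurs. -/
def numConstraints (C : Multiset ℝ) : ℕ := C.toFinset.card

/-- The `ℓ¹` norm. -/
def norm1 {σ : Type*} (x : σ →₀ ℝ) : ℝ := x.sum fun _ a => |a|

/-- The number of non-zero components. -/
def nnz {σ M : Type*} [Zero M] (x : σ →₀ M) : ℕ := x.support.card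

/-- The real vector of an integral vector. -/
def toReal {σ : Type*} (y : σ →₀ ℕ) : σ →₀ ℝ := y.mapRange (fun n : ℕ => (n : ℝ)) Nat.cast_zero

/-- The row of `A x` for the width `w`: how often the width `w` is provided by `x`. -/
def coverage {C : Multiset ℝ} (x : Pattern C →₀ ℝ) (w : ℝ) : ℝ :=
  x.sum fun P a => a * (P.1.count w : ℝ)

/-- `x ≥ 0` and `A x ≥ b`. -/
def Covers (C : Multiset ℝ) (b : ℝ → ℝ) (x : Pattern C →₀ ℝ) : Prop :=
  (∀ P, 0 ≤ x P) ∧ ∀ w ∈ C, b w ≤ coverage x w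

/-- The number of containers of each width. -/
def demand (C : Multiset ℝ) (w : ℝ) : ℝ := (C.count w : ℝ)

/-- `x` is a solution of the relaxation of `LP(C)`. An integral solution is a `y` with values in
`ℕ` such that `toReal y` is a solution. -/
def IsSolution (C : Multiset ℝ) (x : Pattern C →₀ ℝ) : Prop := Covers C (demand C) x

/-- The optimal value of `min ‖x‖` subject to `A x ≥ b`, `x ≥ 0`. -/
def lpValue (C : Multiset ℝ) (b : ℝ → ℝ) : ℝ :=
  sInf {v : ℝ | ∃ x, Covers C b x ∧ norm1 x = v}

/-- The optimal value of the relaxation of `LP(C)`. -/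
def lin (C : Multiset ℝ) : ℝ := lpValue C (demand C)

/-- The optimal value of `LP(C)` with integrality constraints, i.e. the minimum number of
levels. -/
def intOpt (C : Multiset ℝ) : ℝ :=
  sInf {v : ℝ | ∃ y : Pattern C →₀ ℕ, IsSolution C (toReal y) ∧ norm1 (toReal y) = v}

/-- The number of levels that are opened or closed to get from the packing of `y` to the packing
of `y'`: a packing that corresponds with `y` has `y P` levels with pattern `P`. -/
def levelsChanged {C : Multiset ℝ} (y y' : Pattern C →₀ ℕ) : ℝ := norm1 (toReal y' - toReal y)

/-! ### The algorithm Improve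

`Improve α x y` is the procedure of Jansen and Klein. A part of `x` of norm `varMass` is removed
and replaced by an approximate solution of the residual LP. If this lowers the norm, then also the
smallest components of `y` are removed and the part of the fractional solution that belongs to
them is replaced, together with the new part, by a vector with at most `m + 1` non-zero components.
Finally the integral solution is reduced by `α`, as far as possible. -/

/-- The norm of the part of `x` that is replaced, where `X = ‖x‖`: it is `2 α (1 / δ + 1)`. Half of
this is taken in the boundary case `‖x‖ = 2 α (1 / δ + 1)`, where otherwise nothing of `x` would
remain. -/
def varMass (δ : ℝ) (α : ℕ) (X : ℝ) : ℝ :=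
  if 2 * α * (1 / δ + 1) < X then 2 * α * (1 / δ + 1) else α * (1 / δ + 1)

/-- The residual LP is solved with approximation ratio `1 + δ / 2` (exactly in the boundary
case). -/
def accuracy (δ : ℝ) (α : ℕ) (X : ℝ) : ℝ :=
  if 2 * α * (1 / δ + 1) < X then δ / 2 else 0

/-- The part of `x` that is kept. -/
def fixedPart {σ : Type*} (δ : ℝ) (α : ℕ) (x : σ →₀ ℝ) : σ →₀ ℝ :=
  (1 - varMass δ α (norm1 x) / norm1 x) • x

/-- `S` is a set of the `ℓ` smallest non-zero components of `y`, where `ℓ` is the largest number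
such that their sum is at most `s`. -/
def IsSmallestComponents {σ : Type*} (y : σ →₀ ℕ) (s : ℝ) (S : Finset σ) : Prop :=
  S ⊆ y.support ∧ (∀ i ∈ S, ∀ j ∈ y.support, j ∉ S → y i ≤ y j) ∧
  ∑ i ∈ S, (y i : ℝ) ≤ s ∧ ∀ j ∈ y.support, j ∉ S → s < ∑ i ∈ S, (y i : ℝ) + y j

/-- `r` arises from `r₀` by a reduction of the number of non-zero components to at most `m + 1`
that does not increase the norm or decrease the coverage. -/
def IsReduction {C : Multiset ℝ} (r₀ r : Pattern C →₀ ℝ) : Prop :=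
  Covers C (coverage r₀) r ∧ norm1 r ≤ norm1 r₀ ∧ nnz r ≤ numConstraints C + 1

/-- Componentwise rounding up. -/
def ceilVec {σ : Type*} (x : σ →₀ ℝ) : σ →₀ ℕ := x.mapRange Nat.ceil Nat.ceil_zero

/-- The sum of the components of an integral vector. -/
def natTotal {σ : Type*} (y : σ →₀ ℕ) : ℕ := y.sum fun _ n => n

open scoped Classical in
/-- `(x', y')` is a possible output of `Improve α` on `(x, y)`, with parameter `δ`, for `LP(C)`.
Here `xhat` is the solution of the residual LP, `S` is the set of removed components of `y`, and
`yhat` is the integral solution before the final reduction. The final reduction decreases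
components of `yhat`, but not below `⌈x'⌉`, until the norm is at most `‖y‖ - α`. -/
def IsImproveOutput (C : Multiset ℝ) (δ : ℝ) (α : ℕ) (x : Pattern C →₀ ℝ) (y : Pattern C →₀ ℕ)
    (x' : Pattern C →₀ ℝ) (y' : Pattern C →₀ ℕ) : Prop :=
  ∃ (xhat : Pattern C →₀ ℝ) (yhat : Pattern C →₀ ℕ),
    Covers C (fun w => demand C w - coverage (fixedPart δ α x) w) xhat ∧
    norm1 xhat ≤ (1 + accuracy δ α (norm1 x)) *
      lpValue C (fun w => demand C w - coverage (fixedPart δ α x) w) ∧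
    ((norm1 x ≤ norm1 (fixedPart δ α x + xhat) ∧ x' = x ∧ yhat = y) ∨
      (norm1 (fixedPart δ α x + xhat) < norm1 x ∧
        ∃ (S : Finset (Pattern C)) (r : Pattern C →₀ ℝ),
          IsSmallestComponents y ((numConstraints C + 2) * (1 / δ + 2)) S ∧
          IsReduction (xhat + (fixedPart δ α x).filter (· ∈ S)) r ∧
          x' = (fixedPart δ α x).filter (· ∉ S) + r ∧
          yhat = ceilVec x' ⊔ y.filter (· ∉ S))) ∧
    ceilVec x' ≤ y' ∧ y' ≤ yhat ∧
    natTotal y' = max (natTotal (ceilVec x')) (min (natTotal yhat) (natTotal y - α))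

end

end StripPacking

/-!
**Rounding.** A packing of the items of height `H` is cut by horizontal lines. The measures of the
heights at which a given set of items is cut form a fractional covering of the items by sets of
total width at most `1` (`LargeInstance.IsPacking.exists_slices`). In it, each item of a group is
replaced by containers of the next group of the same block, which are not wider by the sorting
property (`exists_coverage_of_slices`). The next group has at most as many containers, and the items
of a group fill its containers up to a small loss; hence `(1 + ε) H / h_B` levels provide all
containers, except those of the groups `(l, A, 0)`, `(l, A, 1)` and `(l, B, 0)`, whose left
neighbour may be too small. These are packed separately, `2 ^ l` on a level. Since there are at most
`ω` categories and a group needs at most `k` levels, this costs at most `3 ω k ≤ ε SIZE / h_B`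
levels, and `SIZE ≤ H`. A fractional solution can be reduced to `m + 1` non-zero components by
Carathéodory's theorem for cones, and rounded up. Finally, the area of the items bounds the number
of groups, and so `m + 1 ≤ 36 / ε ^ 4` (`Invariant.numConstraints_add_one_le`). Together this is
`Invariant.intOpt_le_opt`.

**Improve.** By rounding, `T = (1 + Δ) OPT + (1 + δ) z` is an upper bound of `(1 + δ) LIN`, and by
assumption of `‖x‖`. The residual LP is solved by the share `v / ‖x‖` of an optimal solution, and
`v` is chosen such that the new norm is at most `T - α` (`norm1_fixedPart_add_le`). For the number
of non-zero components, either at least `m + 1` components of `y` are removed, which outweigh the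
components of the reduced part; or one more component would raise the sum of the at most `m` removed
ones above `(m + 2) (1 / δ + 2)`, so that each remaining component is at least `1 / δ + 2`, and the
bound of `‖y‖` limits their number to `D - (m + 1)` (`card_support_sdiff_le`). Rounding up `x'`
costs at most one per component, which gives `‖⌈x'⌉‖ ≤ T - α + D`. The vectors `y` and `ŷ` both
differ from the kept part of `y` by `O((m + α) (1 + 1 / δ))` (`improve_replacement`), and the final
reduction changes `ŷ` by at most `α` more than that.
-/

namespace StripPacking

open Finsupp

/-! ### Conic combinations -/

/-- Carathéodory's theorem for cones: a conic combination of vectors of a `d`-dimensional space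
is a conic combination of at most `d` of them. -/
lemma exists_nonneg_linearCombination_card_le {σ E : Type*} [AddCommGroup E] [Module ℝ E]
    [FiniteDimensional ℝ E] (v : σ → E) (x : σ →₀ ℝ) (hx : 0 ≤ x) :
    ∃ r : σ →₀ ℝ, 0 ≤ r ∧ linearCombination ℝ v r = linearCombination ℝ v x ∧
      r.support.card ≤ Module.finrank ℝ E := by
  induction hn : x.support.card using Nat.strong_induction_on generalizing x with
  | _ n ih =>
  by_cases hle : x.support.card ≤ Module.finrank ℝ E
  · exact ⟨x, hx, rfl, hle⟩
  have hdep : ¬ LinearIndepOn ℝ v (x.support : Set σ) := fun hli => hle (by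
    have := LinearIndependent.fintype_card_le_finrank hli
    simpa using this)
  rw [linearIndepOn_iff] at hdep
  push Not at hdep
  -- a linear relation among the vectors used, with some positive coefficient
  obtain ⟨g, hgs, hg0, i₀, hi₀⟩ : ∃ g : σ →₀ ℝ, g ∈ supported ℝ ℝ (x.support : Set σ) ∧
      linearCombination ℝ v g = 0 ∧ ∃ i, 0 < g i := by
    obtain ⟨g, hgs, hg0, hgne⟩ := hdep
    obtain ⟨i, hi⟩ : ∃ i, g i ≠ 0 := by
      by_contra! h
      exact hgne (Finsupp.ext h)
    rcases lt_or_gt_of_ne hi with h | h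
    · exact ⟨-g, Submodule.neg_mem _ hgs, by simp [hg0], i, by simpa using h⟩
    · exact ⟨g, hgs, hg0, i, h⟩
  rw [mem_supported] at hgs
  have hmem : ∀ i, g i ≠ 0 → i ∈ x.support := fun i hi => hgs (by simpa using hi)
  obtain ⟨j, hj, hjmin⟩ := Finset.exists_min_image (x.support.filter (fun i => 0 < g i))
    (fun i => x i / g i) ⟨i₀, by simpa [hi₀] using hmem i₀ hi₀.ne'⟩
  rw [Finset.mem_filter] at hj
  have ht : 0 ≤ x j / g j := div_nonneg (hx j) hj.2.le
  have hnonneg : 0 ≤ x - (x j / g j) • g := by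
    intro i
    simp only [coe_zero, Pi.zero_apply, coe_sub, coe_smul, Pi.sub_apply, Pi.smul_apply,
      smul_eq_mul, sub_nonneg]
    by_cases hgi : 0 < g i
    · have := hjmin i (by simpa [hgi] using hmem i hgi.ne')
      rwa [le_div_iff₀ hgi] at this
    · exact (mul_nonpos_of_nonneg_of_nonpos ht (not_lt.1 hgi)).trans (hx i)
  have hlt : (x - (x j / g j) • g).support.card < n := by
    rw [← hn]
    refine Finset.card_lt_card (Finset.ssubset_iff_subset_ne.2 ⟨fun i hi => ?_, fun heq => ?_⟩)
    · by_contra hxi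
      have h1 : g i = 0 := by
        by_contra h
        exact hxi (hmem i h)
      have h2 : x i = 0 := by simpa using hxi
      simp [h1, h2] at hi
    · have : j ∉ (x - (x j / g j) • g).support := by
        simp [div_mul_cancel₀ _ hj.2.ne']
      exact this (heq ▸ hj.1)
  obtain ⟨r, hr0, hrv, hrc⟩ := ih _ hlt _ hnonneg rfl
  exact ⟨r, hr0, by rw [hrv]; simp [hg0], hrc⟩

lemma linearCombination_mono {σ : Type*} {v : σ → ℝ} (hv : ∀ i, 0 ≤ v i) {x y : σ →₀ ℝ}
    (h : x ≤ y) : linearCombination ℝ v x ≤ linearCombination ℝ v y := by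
  rw [← sub_nonneg, ← map_sub, linearCombination_apply]
  exact Finset.sum_nonneg fun i _ => mul_nonneg (by simpa using h i) (hv i)

/-! ### The `ℓ¹` norm and rounding -/

section Norm

variable {σ : Type*}

lemma norm1_eq_sum_of_subset (x : σ →₀ ℝ) {s : Finset σ} (h : x.support ⊆ s) :
    norm1 x = ∑ i ∈ s, |x i| :=
  Finsupp.sum_of_support_subset x h _ (by simp)

lemma norm1_nonneg (x : σ →₀ ℝ) : 0 ≤ norm1 x := Finset.sum_nonneg fun _ _ => abs_nonneg _

@[simp] lemma norm1_zero : norm1 (0 : σ →₀ ℝ) = 0 := by simp [norm1]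

lemma norm1_eq_linearCombination {x : σ →₀ ℝ} (hx : 0 ≤ x) :
    norm1 x = linearCombination ℝ (fun _ => (1 : ℝ)) x := by
  simp only [norm1, linearCombination_apply, Finsupp.sum, smul_eq_mul, mul_one]
  exact Finset.sum_congr rfl fun i _ => abs_of_nonneg (hx i)

lemma norm1_add {x y : σ →₀ ℝ} (hx : 0 ≤ x) (hy : 0 ≤ y) :
    norm1 (x + y) = norm1 x + norm1 y := by
  rw [norm1_eq_linearCombination hx, norm1_eq_linearCombination hy,
    norm1_eq_linearCombination (add_nonneg hx hy), map_add]

lemma norm1_smul {c : ℝ} (hc : 0 ≤ c) {x : σ →₀ ℝ} (hx : 0 ≤ x) :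
    norm1 (c • x) = c * norm1 x := by
  rw [norm1_eq_linearCombination hx, norm1_eq_linearCombination (smul_nonneg hc hx), map_smul,
    smul_eq_mul]

lemma norm1_mono {x y : σ →₀ ℝ} (hx : 0 ≤ x) (h : x ≤ y) : norm1 x ≤ norm1 y := by
  rw [norm1_eq_linearCombination hx, norm1_eq_linearCombination (hx.trans h)]
  exact linearCombination_mono (fun _ => zero_le_one) h

lemma norm1_add_le (x y : σ →₀ ℝ) : norm1 (x + y) ≤ norm1 x + norm1 y := by
  classical
  rw [norm1_eq_sum_of_subset (x + y) Finsupp.support_add,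
    norm1_eq_sum_of_subset x Finset.subset_union_left,
    norm1_eq_sum_of_subset y Finset.subset_union_right, ← Finset.sum_add_distrib]
  exact Finset.sum_le_sum fun i _ => abs_add_le _ _

@[simp] lemma toReal_apply (y : σ →₀ ℕ) (i : σ) : toReal y i = y i := rfl

lemma toReal_nonneg (y : σ →₀ ℕ) : 0 ≤ toReal y := fun i => by simp

lemma toReal_mono {y z : σ →₀ ℕ} (h : y ≤ z) : toReal y ≤ toReal z := fun i => by
  simpa using h i

lemma support_toReal (y : σ →₀ ℕ) : (toReal y).support = y.support := by ext; simp

lemma norm1_toReal (y : σ →₀ ℕ) : norm1 (toReal y) = natTotal y := by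
  rw [norm1, Finsupp.sum, support_toReal, natTotal, Finsupp.sum, Nat.cast_sum]
  simp

lemma natTotal_mono {y z : σ →₀ ℕ} (h : y ≤ z) : natTotal y ≤ natTotal z := by
  have := norm1_mono (toReal_nonneg y) (toReal_mono h)
  rw [norm1_toReal, norm1_toReal] at this
  exact_mod_cast this

lemma natTotal_add (y z : σ →₀ ℕ) : natTotal (y + z) = natTotal y + natTotal z := by
  classical
  exact Finsupp.sum_add_index' (by simp) (by simp)

lemma norm1_toReal_sub {y z : σ →₀ ℕ} (h : y ≤ z) :
    norm1 (toReal z - toReal y) = natTotal z - natTotal y := by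
  have h1 : 0 ≤ toReal z - toReal y := sub_nonneg.2 (toReal_mono h)
  have := norm1_add h1 (toReal_nonneg y)
  rw [sub_add_cancel, norm1_toReal, norm1_toReal] at this
  linarith

lemma norm1_sub_comm (x y : σ →₀ ℝ) : norm1 (x - y) = norm1 (y - x) := by
  rw [← neg_sub, norm1, norm1, Finsupp.sum, Finsupp.sum, Finsupp.support_neg]
  simp [abs_sub_comm]

@[simp] lemma ceilVec_apply (x : σ →₀ ℝ) (i : σ) : ceilVec x i = ⌈x i⌉₊ := rfl

lemma le_toReal_ceilVec (x : σ →₀ ℝ) : x ≤ toReal (ceilVec x) := fun i => by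
  simpa using Nat.le_ceil (x i)

lemma ceilVec_le_iff {x : σ →₀ ℝ} {y : σ →₀ ℕ} : ceilVec x ≤ y ↔ ∀ i, x i ≤ y i := by
  simp [Finsupp.le_def]

lemma support_ceilVec {x : σ →₀ ℝ} (hx : 0 ≤ x) : (ceilVec x).support = x.support := by
  ext i
  have : 0 ≤ x i := hx i
  simp only [mem_support_iff, ceilVec_apply, ne_eq, Nat.ceil_eq_zero]
  exact ⟨fun h h' => h h'.le, fun h h' => h (le_antisymm h' this)⟩

/-- Rounding up costs less than one per non-zero component. -/
lemma natTotal_ceilVec_le {x : σ →₀ ℝ} (hx : 0 ≤ x) :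
    (natTotal (ceilVec x) : ℝ) ≤ norm1 x + nnz x := by
  rw [← norm1_toReal, norm1, Finsupp.sum, support_toReal, support_ceilVec hx, norm1, Finsupp.sum,
    nnz, Finset.card_eq_sum_ones, Nat.cast_sum, ← Finset.sum_add_distrib]
  refine Finset.sum_le_sum fun i _ => ?_
  have : 0 ≤ x i := hx i
  simpa [abs_of_nonneg this] using (Nat.ceil_lt_add_one this).le

lemma filter_nonneg {x : σ →₀ ℝ} (hx : 0 ≤ x) (p : σ → Prop) [DecidablePred p] :
    0 ≤ x.filter p := fun i => by
  rw [filter_apply]; split_ifs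
  exacts [hx i, le_rfl]

lemma filter_mem_add_filter_notMem {M : Type*} [AddZeroClass M] (x : σ →₀ M) (S : Finset σ)
    [DecidablePred (· ∈ S)] [DecidablePred (· ∉ S)] :
    x.filter (· ∈ S) + x.filter (· ∉ S) = x := by
  ext i
  simp only [coe_add, Pi.add_apply, filter_apply]
  by_cases h : i ∈ S <;> simp [h]

/-- Between two comparable integral vectors there is one with each intermediate sum. -/
lemma exists_natTotal_eq {a b : σ →₀ ℕ} (hab : a ≤ b) {t : ℕ} (hat : natTotal a ≤ t)
    (htb : t ≤ natTotal b) : ∃ y, a ≤ y ∧ y ≤ b ∧ natTotal y = t := by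
  classical
  induction t, hat using Nat.le_induction with
  | base => exact ⟨a, le_rfl, hab, rfl⟩
  | succ t _ ih =>
    obtain ⟨y, hay, hyb, hyt⟩ := ih (by omega)
    obtain ⟨i, hi⟩ : ∃ i, y i < b i := by
      by_contra! h
      have := natTotal_mono (show b ≤ y from h)
      omega
    refine ⟨y + single i 1, hay.trans (by simp), fun j => ?_, ?_⟩
    · by_cases hj : j = i
      · subst hj; simpa using hi
      · simpa [single_apply, Ne.symm hj] using hyb j
    · rw [natTotal_add, hyt]; simp [natTotal]

end Norm

/-! ### The configuration LP -/

section LP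

variable {C : Multiset ℝ}

lemma coverage_eq_linearCombination (x : Pattern C →₀ ℝ) (w : ℝ) :
    coverage x w = linearCombination ℝ (fun P : Pattern C => (P.1.count w : ℝ)) x := rfl

lemma coverage_add (x y : Pattern C →₀ ℝ) (w : ℝ) :
    coverage (x + y) w = coverage x w + coverage y w := by
  simp [coverage_eq_linearCombination]

lemma coverage_smul (c : ℝ) (x : Pattern C →₀ ℝ) (w : ℝ) :
    coverage (c • x) w = c * coverage x w := by
  simp [coverage_eq_linearCombination]

lemma coverage_sum {β : Type*} (s : Finset β) (f : β → Pattern C →₀ ℝ) (w : ℝ) :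
    coverage (∑ b ∈ s, f b) w = ∑ b ∈ s, coverage (f b) w := by
  simp [coverage_eq_linearCombination]

lemma coverage_single (P : Pattern C) (a w : ℝ) :
    coverage (single P a) w = a * (P.1.count w : ℝ) := by
  simp [coverage_eq_linearCombination]

lemma coverage_mono {x y : Pattern C →₀ ℝ} (h : x ≤ y) (w : ℝ) : coverage x w ≤ coverage y w :=
  linearCombination_mono (fun _ => Nat.cast_nonneg _) h

lemma Covers.nonneg {b : ℝ → ℝ} {x : Pattern C →₀ ℝ} (h : Covers C b x) : 0 ≤ x := h.1

lemma IsSolution.mono {x y : Pattern C →₀ ℝ} (hx : IsSolution C x) (h : x ≤ y) :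
    IsSolution C y :=
  ⟨fun P => (hx.1 P).trans (h P), fun w hw => (hx.2 w hw).trans (coverage_mono h w)⟩

/-- The number of non-zero components can be reduced to `m + 1`, since this is the number of rows
of `A` and of the norm together. -/
lemma exists_isReduction {r₀ : Pattern C →₀ ℝ} (h₀ : 0 ≤ r₀) : ∃ r, IsReduction r₀ r := by
  obtain ⟨r, hr, hrv, hrc⟩ := exists_nonneg_linearCombination_card_le
    (fun P : Pattern C => ((fun w => (P.1.count w.1 : ℝ), 1) : (C.toFinset → ℝ) × ℝ)) r₀ h₀
  have hsnd := congrArg Prod.snd hrv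
  have hfst := fun w => congrFun (congrArg Prod.fst hrv) w
  simp only [linearCombination_apply, Finsupp.sum, Prod.snd_sum, Prod.fst_sum, Finset.sum_apply,
    Prod.smul_fst, Prod.smul_snd, Pi.smul_apply] at hsnd hfst
  refine ⟨r, ⟨hr, fun w hw => ?_⟩, ?_, ?_⟩
  · exact (hfst ⟨w, Multiset.mem_toFinset.2 hw⟩).ge
  · rw [norm1_eq_linearCombination hr, norm1_eq_linearCombination h₀]
    exact hsnd.le
  · rw [Module.finrank_prod, Module.finrank_fintype_fun_eq_card, Fintype.card_coe,
      Module.finrank_self] at hrc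
    exact hrc

/-- Widths that are bounded away from `0` admit only finitely many patterns. -/
lemma finite_pattern {ε : ℝ} (hε : 0 < ε) (hC : ∀ w ∈ C, ε ≤ w) : Finite (Pattern C) := by
  have key : ∀ P : Pattern C, P.1 ≤ ⌈1 / ε⌉₊ • C.toFinset.val := by
    intro P
    have hcard : (P.1.card : ℝ) ≤ ⌈1 / ε⌉₊ := by
      have h1 : P.1.card • ε ≤ P.1.sum :=
        Multiset.card_nsmul_le_sum fun w hw => hC w (P.2.1 w hw)
      have h2 := h1.trans P.2.2
      rw [nsmul_eq_mul, ← le_div_iff₀ hε] at h2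
      exact h2.trans (Nat.le_ceil _)
    rw [Multiset.le_iff_count]
    intro w
    by_cases hw : w ∈ P.1
    · have hwC := P.2.1 w hw
      have : (C.toFinset.val).count w = 1 :=
        Multiset.count_eq_one_of_mem C.toFinset.nodup (Multiset.mem_toFinset.2 hwC)
      rw [Multiset.count_nsmul, this, mul_one]
      exact (Multiset.count_le_card _ _).trans (by exact_mod_cast hcard)
    · simp [Multiset.count_eq_zero_of_notMem hw]
  exact Finite.of_injective
    (fun P : Pattern C => (⟨P.1, key P⟩ : Set.Iic (⌈1 / ε⌉₊ • C.toFinset.val)))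
    fun P Q h => Subtype.ext
      (congrArg (fun s : Set.Iic (⌈1 / ε⌉₊ • C.toFinset.val) => s.1) h)

lemma lpValue_le {b : ℝ → ℝ} {x : Pattern C →₀ ℝ} (hx : Covers C b x) :
    lpValue C b ≤ norm1 x :=
  csInf_le ⟨0, by rintro _ ⟨x, _, rfl⟩; exact norm1_nonneg x⟩ ⟨x, hx, rfl⟩

/-- The optimal value of a feasible LP is attained, by compactness. -/
lemma exists_norm1_eq_lpValue [Finite (Pattern C)] {b : ℝ → ℝ} {x₀ : Pattern C →₀ ℝ}
    (h₀ : Covers C b x₀) : ∃ x, Covers C b x ∧ norm1 x = lpValue C b := by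
  classical
  have := Fintype.ofFinite (Pattern C)
  let e := Finsupp.linearEquivFunOnFinite ℝ ℝ (Pattern C)
  have hnorm : ∀ f : Pattern C → ℝ, norm1 (e.symm f) = ∑ P, |f P| := fun f =>
    norm1_eq_sum_of_subset _ (Finset.subset_univ _)
  have hcov : ∀ (f : Pattern C → ℝ) w, coverage (e.symm f) w = ∑ P, f P * (P.1.count w : ℝ) :=
    fun f w => Finsupp.sum_of_support_subset _ (Finset.subset_univ _) _ (by simp)
  let K : Set (Pattern C → ℝ) :=
    Set.Icc 0 (fun _ => norm1 x₀) ∩ {f | ∀ w ∈ C, b w ≤ ∑ P, f P * (P.1.count w : ℝ)}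
  have hmemK : ∀ x : Pattern C →₀ ℝ, Covers C b x → norm1 x ≤ norm1 x₀ → e x ∈ K := by
    intro x hx hle
    refine ⟨⟨hx.1, fun P => ?_⟩, fun w hw => ?_⟩
    · rw [norm1_eq_sum_of_subset x (Finset.subset_univ _)] at hle
      exact (le_abs_self _).trans ((Finset.single_le_sum (f := fun P => |x P|)
        (fun P _ => abs_nonneg _) (Finset.mem_univ P)).trans hle)
    · have := hx.2 w hw
      rwa [← e.symm_apply_apply x, hcov] at this
  have hK : IsCompact K := by
    refine isCompact_Icc.inter_right ?_
    simp only [Set.ofPred_forall]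
    refine isClosed_iInter fun w => isClosed_iInter fun _ => ?_
    exact isClosed_le continuous_const (by fun_prop)
  obtain ⟨f, hf, hmin⟩ := hK.exists_isMinOn ⟨e x₀, hmemK x₀ h₀ le_rfl⟩
    (f := fun f => ∑ P, |f P|) (by fun_prop)
  have hfc : Covers C b (e.symm f) :=
    ⟨hf.1.1, fun w hw => by rw [hcov]; exact hf.2 w hw⟩
  have hle : ∀ x, Covers C b x → norm1 x ≤ norm1 x₀ → norm1 (e.symm f) ≤ norm1 x := by
    intro x hx hxle
    have : ∑ P, |f P| ≤ ∑ P, |e x P| := hmin (hmemK x hx hxle)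
    rwa [← hnorm, ← hnorm, e.symm_apply_apply] at this
  refine ⟨e.symm f, hfc, le_antisymm (le_csInf ⟨_, x₀, h₀, rfl⟩ ?_) (lpValue_le hfc)⟩
  rintro _ ⟨x, hx, rfl⟩
  rcases le_total (norm1 x) (norm1 x₀) with h | h
  · exact hle x hx h
  · exact (hle x₀ h₀ le_rfl).trans h

lemma intOpt_le {y : Pattern C →₀ ℕ} (hy : IsSolution C (toReal y)) :
    intOpt C ≤ natTotal y := by
  rw [← norm1_toReal]
  exact csInf_le ⟨0, by rintro _ ⟨x, _, rfl⟩; exact norm1_nonneg _⟩ ⟨y, hy, rfl⟩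

/-- Rounding a reduced fractional solution up opens at most `m + 1` additional levels. -/
lemma intOpt_le_norm1_add {x : Pattern C →₀ ℝ} (hx : IsSolution C x) :
    intOpt C ≤ norm1 x + (numConstraints C + 1) := by
  obtain ⟨r, hr, hrn, hrc⟩ := exists_isReduction hx.nonneg
  have hrs : IsSolution C r := ⟨hr.1, fun w hw => (hx.2 w hw).trans (hr.2 w hw)⟩
  refine (intOpt_le (hrs.mono (le_toReal_ceilVec r))).trans ?_
  have h1 := natTotal_ceilVec_le hrs.nonneg
  have h2 : (nnz r : ℝ) ≤ numConstraints C + 1 := by exact_mod_cast hrc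
  linarith

lemma lin_le_intOpt {y : Pattern C →₀ ℕ} (hy : IsSolution C (toReal y)) : lin C ≤ intOpt C := by
  refine le_csInf ⟨_, y, hy, rfl⟩ ?_
  rintro _ ⟨z, hz, rfl⟩
  exact lpValue_le hz

end LP

/-! ### The algorithm Improve -/

section Improve

/-- The identity `α (1 + δ) = v (δ - ρ)` says that replacing the mass `v` with approximation ratio
`1 + ρ` gains exactly `α` on a solution of norm `(1 + δ) LIN`. -/
lemma varMass_accuracy_spec {δ : ℝ} (hδ : 0 < δ) (α : ℕ) {X : ℝ}
    (h : 2 * α * (1 / δ + 1) ≤ X) :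
    0 ≤ varMass δ α X ∧ varMass δ α X ≤ 2 * α * (1 / δ + 1) ∧ 0 ≤ accuracy δ α X ∧
      accuracy δ α X ≤ δ ∧ (α : ℝ) * (1 + δ) = varMass δ α X * (δ - accuracy δ α X) ∧
      (0 < X → varMass δ α X < X) := by
  have hq : 0 < 1 / δ + 1 := by positivity
  have hα : 0 ≤ α * (1 / δ + 1) := by positivity
  unfold varMass accuracy
  split_ifs with hlt
  · refine ⟨by linarith, le_rfl, by positivity, by linarith, ?_, fun _ => hlt⟩
    field_simp
    ring
  · refine ⟨hα, by linarith, le_rfl, hδ.le, ?_, fun hX => by linarith⟩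
    field_simp
    ring

variable {C : Multiset ℝ} {δ : ℝ} {α : ℕ} {x : Pattern C →₀ ℝ}

lemma varMass_div_mem_Icc (hδ : 0 < δ) (hα : 2 * α * (1 / δ + 1) ≤ norm1 x) :
    0 ≤ varMass δ α (norm1 x) / norm1 x ∧ varMass δ α (norm1 x) / norm1 x ≤ 1 := by
  obtain ⟨h0, -, -, -, -, hlt⟩ := varMass_accuracy_spec hδ α hα
  refine ⟨div_nonneg h0 (norm1_nonneg x), ?_⟩
  rcases (norm1_nonneg x).eq_or_lt with h | h
  · simp [← h]
  · exact (div_le_one h).2 (hlt h).le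

lemma fixedPart_nonneg (hδ : 0 < δ) (hα : 2 * α * (1 / δ + 1) ≤ norm1 x) (hx : 0 ≤ x) :
    0 ≤ fixedPart δ α x :=
  smul_nonneg (sub_nonneg.2 (varMass_div_mem_Icc hδ hα).2) hx

lemma fixedPart_le (hδ : 0 < δ) (hα : 2 * α * (1 / δ + 1) ≤ norm1 x) (hx : 0 ≤ x) :
    fixedPart δ α x ≤ x := fun P => by
  have h1 := (varMass_div_mem_Icc hδ hα).1
  have h2 : 0 ≤ x P := hx P
  simp only [fixedPart, coe_smul, Pi.smul_apply, smul_eq_mul]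
  nlinarith

lemma support_fixedPart (hδ : 0 < δ) (hα : 2 * α * (1 / δ + 1) ≤ norm1 x)
    (hX : 0 < norm1 x) : (fixedPart δ α x).support = x.support := by
  obtain ⟨-, -, -, -, -, hlt⟩ := varMass_accuracy_spec hδ α hα
  refine Finsupp.support_smul_eq (ne_of_gt ?_)
  rw [sub_pos, div_lt_one hX]
  exact hlt hX

lemma norm1_fixedPart (hδ : 0 < δ) (hα : 2 * α * (1 / δ + 1) ≤ norm1 x) (hx : 0 ≤ x) :
    norm1 (fixedPart δ α x) = (1 - varMass δ α (norm1 x) / norm1 x) * norm1 x :=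
  norm1_smul (sub_nonneg.2 (varMass_div_mem_Icc hδ hα).2) hx

/-- The part of an optimal solution that corresponds to the removed share of `x` solves the
residual LP. -/
lemma covers_residual (hδ : 0 < δ) (hα : 2 * α * (1 / δ + 1) ≤ norm1 x)
    (hx : IsSolution C x) {z : Pattern C →₀ ℝ} (hz : IsSolution C z) :
    Covers C (fun w => demand C w - coverage (fixedPart δ α x) w)
      ((varMass δ α (norm1 x) / norm1 x) • z) := by
  obtain ⟨h0, h1⟩ := varMass_div_mem_Icc hδ hα
  refine ⟨smul_nonneg h0 hz.nonneg, fun w hw => ?_⟩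
  have hxw := mul_le_mul_of_nonneg_left (hx.2 w hw) (sub_nonneg.2 h1)
  have hzw := mul_le_mul_of_nonneg_left (hz.2 w hw) h0
  simp only [fixedPart, coverage_smul]
  linarith

/-- The norm bound of the improved fractional solution, for any common upper bound `T` of `‖x‖`
and `(1 + δ) LIN`. -/
lemma norm1_fixedPart_add_le [Finite (Pattern C)] {T : ℝ} {xhat : Pattern C →₀ ℝ} (hδ : 0 < δ)
    (hα : 2 * α * (1 / δ + 1) ≤ norm1 x) (hx : IsSolution C x) (hxT : norm1 x ≤ T)
    (hT : (1 + δ) * lin C ≤ T)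
    (hcov : Covers C (fun w => demand C w - coverage (fixedPart δ α x) w) xhat)
    (hopt : norm1 xhat ≤ (1 + accuracy δ α (norm1 x)) *
      lpValue C (fun w => demand C w - coverage (fixedPart δ α x) w)) :
    norm1 (fixedPart δ α x + xhat) ≤ T - α := by
  obtain ⟨z, hz, hzn⟩ := exists_norm1_eq_lpValue hx
  obtain ⟨h0, hv, hρ0, hρδ, hid, hlt⟩ := varMass_accuracy_spec hδ α hα
  obtain ⟨hc0, hc1⟩ := varMass_div_mem_Icc hδ hα
  have hres := lpValue_le (covers_residual hδ hα hx hz)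
  rw [norm1_smul hc0 hz.nonneg, hzn] at hres
  rw [norm1_add (fixedPart_nonneg hδ hα hx.nonneg) hcov.nonneg,
    norm1_fixedPart hδ hα hx.nonneg]
  have hcX : varMass δ α (norm1 x) / norm1 x * norm1 x = varMass δ α (norm1 x) := by
    rcases (norm1_nonneg x).eq_or_lt with h | h
    · rw [← h] at hα ⊢
      have := varMass_accuracy_spec hδ α hα
      simp only [mul_zero]
      linarith
    · exact div_mul_cancel₀ _ h.ne'
  change lpValue C _ ≤ _ * lin C at hres
  set X := norm1 x
  set ρ := accuracy δ α X
  set c := varMass δ α X / X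
  have h1 : norm1 xhat ≤ (1 + ρ) * (c * lin C) :=
    hopt.trans (mul_le_mul_of_nonneg_left hres (by linarith))
  -- `T` is split as `(1 - c) T + c T`; the first part pays for the kept share of `x`, and the
  -- second one for the new share and for `α = c X (δ - ρ) / (1 + δ)`
  have h2 : (1 - c) * X ≤ (1 - c) * T := mul_le_mul_of_nonneg_left hxT (by linarith)
  have h3 : c * ((1 + ρ) * ((1 + δ) * lin C)) ≤ c * ((1 + ρ) * T) := by gcongr
  have h4 : c * ((δ - ρ) * X) ≤ c * ((δ - ρ) * T) := by
    have : 0 ≤ δ - ρ := by linarith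
    gcongr
  have h5 : α * (1 + δ) = c * ((δ - ρ) * X) := by
    rw [hid, ← hcX]; ring
  have h6 : (1 + δ) * ((1 + ρ) * (c * lin C) + α) ≤ (1 + δ) * (c * T) := by
    linarith
  have h7 := le_of_mul_le_mul_left h6 (by positivity)
  linarith

/-- The set `S` of removed components exists: take a largest set of smallest components that
satisfies the bound. -/
lemma exists_isSmallestComponents {σ : Type*} (y : σ →₀ ℕ) {s : ℝ} (hs : 0 ≤ s) :
    ∃ S, IsSmallestComponents y s S := by
  classical
  obtain ⟨S, hS, hmax⟩ := Finset.exists_max_image (y.support.powerset.filter fun S =>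
    (∀ i ∈ S, ∀ j ∈ y.support, j ∉ S → y i ≤ y j) ∧ ∑ i ∈ S, (y i : ℝ) ≤ s) Finset.card
    ⟨∅, by simpa using hs⟩
  simp only [Finset.mem_filter, Finset.mem_powerset] at hS hmax
  refine ⟨S, hS.1, hS.2.1, hS.2.2, ?_⟩
  by_contra! hcon
  obtain ⟨j₀, hj₀, hj₀S, hj₀s⟩ := hcon
  obtain ⟨j, hj, hjmin⟩ := Finset.exists_min_image (y.support \ S) y ⟨j₀, by simp_all⟩
  rw [Finset.mem_sdiff] at hj
  have hjj₀ : y j ≤ y j₀ := hjmin j₀ (Finset.mem_sdiff.2 ⟨hj₀, hj₀S⟩)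
  have hcard := hmax (insert j S) ⟨Finset.insert_subset hj.1 hS.1, ?_, ?_⟩
  · rw [Finset.card_insert_of_notMem hj.2] at hcard
    omega
  · intro i hi k hk hkS
    rw [Finset.mem_insert, not_or] at hkS
    rcases Finset.mem_insert.1 hi with rfl | hi
    · exact hjmin k (Finset.mem_sdiff.2 ⟨hk, hkS.2⟩)
    · exact hS.2.1 i hi k hk hkS.2
  · rw [Finset.sum_insert hj.2]
    have : (y j : ℝ) ≤ y j₀ := by exact_mod_cast hjj₀
    linarith

/-- If few components of `y` are removed, then the remaining ones are large, and so there are not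
many of them. -/
lemma card_support_sdiff_le {σ : Type*} [DecidableEq σ] {y : σ →₀ ℕ} {q M B : ℝ} {m : ℕ}
    {S : Finset σ} (hq : 0 < q) (hS : IsSmallestComponents y ((m + 2) * q) S)
    (hyM : (natTotal y : ℝ) ≤ M) (hMB : M ≤ q * B) (hB : (nnz y : ℝ) ≤ B)
    (hmB : (m : ℝ) + 1 ≤ B) : ((y.support \ S).card : ℝ) + (m + 1) ≤ B := by
  obtain ⟨hsub, hmin, hsum, hmax⟩ := hS
  have hcard : (((y.support \ S).card + S.card : ℕ) : ℝ) = nnz y := by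
    rw [Finset.card_sdiff_add_card_eq_card hsub, nnz]
  push_cast at hcard
  rcases (y.support \ S).eq_empty_or_nonempty with hempty | hne
  · simpa [hempty] using hmB
  by_cases hSm : m + 1 ≤ S.card
  · have : (m : ℝ) + 1 ≤ S.card := by exact_mod_cast hSm
    linarith
  obtain ⟨j, hj, hjmin⟩ := Finset.exists_min_image _ y hne
  have hj' := Finset.mem_sdiff.1 hj
  have hbig := hmax j hj'.1 hj'.2
  have hSm' : (S.card : ℝ) ≤ m := by
    have : S.card ≤ m := by omega
    exact_mod_cast this
  have hSj : ∑ i ∈ S, (y i : ℝ) ≤ S.card * y j := by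
    rw [← nsmul_eq_mul]
    exact Finset.sum_le_card_nsmul _ _ _ fun i hi => by exact_mod_cast hmin i hi j hj'.1 hj'.2
  have hqj : q ≤ y j := by
    have h0 : (0 : ℝ) ≤ y j := Nat.cast_nonneg _
    have : (S.card : ℝ) * y j ≤ m * y j := by gcongr
    nlinarith
  have hrest : (((y.support \ S).card : ℝ) - 1) * q ≤ ∑ i ∈ (y.support \ S).erase j, (y i : ℝ) := by
    have h1 : (((y.support \ S).erase j).card : ℝ) = (y.support \ S).card - 1 := by
      rw [Finset.card_erase_of_mem hj, Nat.cast_sub hne.card_pos, Nat.cast_one]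
    rw [← h1, ← nsmul_eq_mul]
    refine Finset.card_nsmul_le_sum _ _ _ fun i hi => hqj.trans ?_
    exact_mod_cast hjmin i (Finset.mem_of_mem_erase hi)
  have htot : ∑ i ∈ (y.support \ S).erase j, (y i : ℝ) + y j + ∑ i ∈ S, (y i : ℝ) = natTotal y := by
    rw [Finset.sum_erase_add _ _ hj, Finset.sum_sdiff hsub, natTotal, Finsupp.sum]
    push_cast
    rfl
  have hfin : q * ((y.support \ S).card + (m + 1)) ≤ q * B := by
    linarith
  exact le_of_mul_le_mul_left hfin hq

variable {y : Pattern C →₀ ℕ}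

theorem exists_isImproveOutput [Finite (Pattern C)] (hδ : 0 < δ)
    (hα : 2 * α * (1 / δ + 1) ≤ norm1 x) (hx : IsSolution C x) (hxy : ∀ P, x P ≤ y P) :
    ∃ x' y', IsImproveOutput C δ α x y x' y' := by
  classical
  obtain ⟨-, -, hρ, -⟩ := varMass_accuracy_spec hδ α hα
  obtain ⟨xhat, hcov, hopt⟩ := exists_norm1_eq_lpValue (covers_residual hδ hα hx hx)
  have hopt' : norm1 xhat ≤ (1 + accuracy δ α (norm1 x)) *
      lpValue C (fun w => demand C w - coverage (fixedPart δ α x) w) := by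
    rw [← hopt]
    nlinarith [norm1_nonneg xhat]
  -- it remains to find an integral vector with the prescribed norm
  have hfinal : ∀ (x' : Pattern C →₀ ℝ) (yhat : Pattern C →₀ ℕ), ceilVec x' ≤ yhat →
      ∃ y', ceilVec x' ≤ y' ∧ y' ≤ yhat ∧ natTotal y' =
        max (natTotal (ceilVec x')) (min (natTotal yhat) (natTotal y - α)) := fun x' yhat h =>
    exists_natTotal_eq h (le_max_left _ _) (max_le (natTotal_mono h) (min_le_left _ _))
  by_cases hcase : norm1 x ≤ norm1 (fixedPart δ α x + xhat)
  · obtain ⟨y', h1, h2, h3⟩ := hfinal x y (ceilVec_le_iff.2 hxy)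
    exact ⟨x, y', xhat, y, hcov, hopt', Or.inl ⟨hcase, rfl, rfl⟩, h1, h2, h3⟩
  · obtain ⟨S, hS⟩ := exists_isSmallestComponents y
      (s := (numConstraints C + 2) * (1 / δ + 2)) (by positivity)
    obtain ⟨r, hr⟩ := exists_isReduction (r₀ := xhat + (fixedPart δ α x).filter (· ∈ S))
      (add_nonneg hcov.nonneg (filter_nonneg (fixedPart_nonneg hδ hα hx.nonneg) _))
    obtain ⟨y', h1, h2, h3⟩ := hfinal ((fixedPart δ α x).filter (· ∉ S) + r) _ le_sup_left
    exact ⟨_, y', xhat, _, hcov, hopt', Or.inr ⟨not_le.1 hcase, S, r, hS, hr, rfl, rfl⟩, h1, h2, h3⟩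

/-- The effect of the second case of Improve, before the final reduction of the integral
solution. -/
lemma improve_replacement {D M : ℝ} {xhat r : Pattern C →₀ ℝ}
    {S : Finset (Pattern C)} [DecidablePred (· ∈ S)] [DecidablePred (· ∉ S)]
    (hδ : 0 < δ) (hα : 2 * α * (1 / δ + 1) ≤ norm1 x) (hx : IsSolution C x)
    (hxy : ∀ P, x P ≤ y P) (hnnz : nnz x = nnz y) (hyD : (nnz y : ℝ) ≤ D)
    (hmD : (numConstraints C : ℝ) + 1 ≤ D) (hyM : (natTotal y : ℝ) ≤ M)
    (hMD : M ≤ (1 / δ + 2) * D)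
    (hcov : Covers C (fun w => demand C w - coverage (fixedPart δ α x) w) xhat)
    (hlt : norm1 (fixedPart δ α x + xhat) < norm1 x)
    (hS : IsSmallestComponents y ((numConstraints C + 2) * (1 / δ + 2)) S)
    (hr : IsReduction (xhat + (fixedPart δ α x).filter (· ∈ S)) r) :
    let x' := (fixedPart δ α x).filter (· ∉ S) + r
    let yhat := ceilVec x' ⊔ y.filter (· ∉ S)
    IsSolution C x' ∧ norm1 x' ≤ norm1 (fixedPart δ α x + xhat) ∧
      yhat.support ⊆ x'.support ∧ (nnz x' : ℝ) ≤ D ∧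
      norm1 (toReal yhat - toReal y) ≤ 2 * ((numConstraints C + 2) * (1 / δ + 2)) +
        2 * α * (1 / δ + 1) + (numConstraints C + 1) := by
  classical
  intro x' yhat
  have hX : 0 < norm1 x := (norm1_nonneg _).trans_lt hlt
  have hf0 := fixedPart_nonneg hδ hα hx.nonneg
  have hin := filter_nonneg hf0 (· ∈ S)
  have hout := filter_nonneg hf0 (· ∉ S)
  have hr0 : 0 ≤ r := hr.1.nonneg
  have hsplit := filter_mem_add_filter_notMem (fixedPart δ α x) S
  have hx'0 : 0 ≤ x' := add_nonneg hout hr0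
  have hsupp : x.support = y.support := by
    refine Finset.eq_of_subset_of_card_le (fun P hP => ?_) hnnz.ge
    rw [mem_support_iff] at hP ⊢
    intro h
    have := hxy P
    rw [h, Nat.cast_zero] at this
    exact hP (le_antisymm this (hx.1 P))
  have hfsupp := support_fixedPart hδ hα hX
  have hfy : ∀ P, fixedPart δ α x P ≤ y P := fun P =>
    (fixedPart_le hδ hα hx.nonneg P).trans (hxy P)
  have hnorm_split : norm1 ((fixedPart δ α x).filter (· ∈ S)) +
      norm1 ((fixedPart δ α x).filter (· ∉ S)) = norm1 (fixedPart δ α x) := by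
    rw [← norm1_add hin hout, hsplit]
  have hrn := hr.2.1
  rw [norm1_add hcov.nonneg hin] at hrn
  refine ⟨⟨hx'0, fun w hw => ?_⟩, ?_, ?_, ?_, ?_⟩
  · have h1 := hcov.2 w hw
    have h2 := hr.1.2 w hw
    have h3 := congrArg (fun f => coverage f w) hsplit
    simp only [coverage_add] at h2 h3
    rw [coverage_add]
    linarith
  · rw [norm1_add hout hr0, norm1_add hf0 hcov.nonneg]
    linarith
  · intro P hP
    by_contra hPx
    have hx'P : x' P = 0 := by simpa using hPx
    have hadd : (fixedPart δ α x).filter (· ∉ S) P + r P = 0 := hx'P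
    have h1 : (fixedPart δ α x).filter (· ∉ S) P = 0 :=
      le_antisymm (by linarith [show 0 ≤ r P from hr0 P]) (hout P)
    have h2 : y.filter (· ∉ S) P = 0 := by
      rw [filter_apply] at h1 ⊢
      split_ifs at h1 ⊢ with hPS
      · rfl
      · have : P ∉ y.support := by
          rw [← hsupp, ← hfsupp]
          simpa using h1
        simpa using this
    rw [mem_support_iff] at hP
    apply hP
    change max (ceilVec x' P) (y.filter (· ∉ S) P) = 0
    rw [h2, ceilVec_apply, hx'P]
    simp
  · have h1 : x'.support ⊆ (y.support \ S) ∪ r.support := by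
      refine Finsupp.support_add.trans (Finset.union_subset_union_left fun P hP => ?_)
      rw [support_filter, Finset.mem_filter, hfsupp, hsupp] at hP
      exact Finset.mem_sdiff.2 hP
    have h2 : nnz x' ≤ (y.support \ S).card + (numConstraints C + 1) :=
      (Finset.card_le_card h1).trans ((Finset.card_union_le _ _).trans
        (Nat.add_le_add_left hr.2.2 _))
    have h3 := card_support_sdiff_le (by positivity) hS hyM hMD hyD hmD
    have h4 : (nnz x' : ℝ) ≤ (y.support \ S).card + (numConstraints C + 1) := by
      exact_mod_cast h2
    linarith
  · -- compare both vectors with the kept part of `y`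
    have hySsum : (natTotal (y.filter (· ∈ S)) : ℝ) ≤ (numConstraints C + 2) * (1 / δ + 2) := by
      refine le_trans (le_of_eq ?_) hS.2.2.1
      have : (y.filter (· ∈ S)).support = S := by
        rw [support_filter, Finset.filter_mem_eq_inter, Finset.inter_eq_right]
        exact hS.1
      rw [natTotal, Finsupp.sum, this, Nat.cast_sum]
      exact Finset.sum_congr rfl fun P hP => by rw [filter_apply_pos _ _ hP]
    have hyS : natTotal (y.filter (· ∈ S)) + natTotal (y.filter (· ∉ S)) = natTotal y := by
      rw [← natTotal_add, filter_mem_add_filter_notMem]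
    have hyS' : (natTotal (y.filter (· ∈ S)) : ℝ) + natTotal (y.filter (· ∉ S)) = natTotal y := by
      exact_mod_cast hyS
    have hyle : y.filter (· ∉ S) ≤ y := fun P => by
      rw [filter_apply]; split_ifs <;> simp
    have hyhat : yhat ≤ y.filter (· ∉ S) + ceilVec r := by
      refine sup_le (ceilVec_le_iff.2 fun P => ?_) (by simp)
      have h1 : (fixedPart δ α x).filter (· ∉ S) P ≤ (y.filter (· ∉ S) P : ℕ) := by
        rw [filter_apply, filter_apply]
        split_ifs
        · simp
        · exact hfy P
      have h2 : r P ≤ ⌈r P⌉₊ := Nat.le_ceil _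
      simp only [x', coe_add, Pi.add_apply, Nat.cast_add, ceilVec_apply]
      linarith
    have h1 : (natTotal yhat : ℝ) ≤ natTotal (y.filter (· ∉ S)) + natTotal (ceilVec r) := by
      have := natTotal_mono hyhat
      rw [natTotal_add] at this
      exact_mod_cast this
    have h2 := natTotal_ceilVec_le hr0
    have h3 : (nnz r : ℝ) ≤ numConstraints C + 1 := by exact_mod_cast hr.2.2
    have h4 : norm1 ((fixedPart δ α x).filter (· ∈ S)) ≤ natTotal (y.filter (· ∈ S)) := by
      rw [← norm1_toReal]
      refine norm1_mono hin fun P => ?_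
      rw [toReal_apply, filter_apply, filter_apply]
      split_ifs
      · exact hfy P
      · simp
    have h5 : norm1 xhat ≤ 2 * α * (1 / δ + 1) := by
      rw [norm1_add hf0 hcov.nonneg, norm1_fixedPart hδ hα hx.nonneg, sub_mul, one_mul,
        div_mul_cancel₀ _ hX.ne'] at hlt
      linarith [(varMass_accuracy_spec hδ α hα).2.1]
    have h6 := norm1_toReal_sub hyle
    have h7 := norm1_toReal_sub (le_sup_right : y.filter (· ∉ S) ≤ yhat)
    have h8 := norm1_add_le (toReal yhat - toReal (y.filter (· ∉ S)))
      (toReal (y.filter (· ∉ S)) - toReal y)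
    rw [sub_add_sub_cancel, norm1_sub_comm (toReal (y.filter (· ∉ S))) (toReal y), h6, h7] at h8
    linarith

/-- The effect of Improve, for an upper bound `T` of `‖x‖` and `(1 + δ) LIN`, an upper bound `D` of
the number of non-zero components and an upper bound `M ≥ T + D` of `‖y‖`. -/
theorem IsImproveOutput.spec [Finite (Pattern C)] {T D M : ℝ} {x' : Pattern C →₀ ℝ}
    {y' : Pattern C →₀ ℕ} (hδ : 0 < δ) (hα : 2 * α * (1 / δ + 1) ≤ norm1 x)
    (hx : IsSolution C x) (hxT : norm1 x ≤ T) (hT : (1 + δ) * lin C ≤ T)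
    (hxy : ∀ P, x P ≤ y P) (hnnz : nnz x = nnz y) (hyD : (nnz y : ℝ) ≤ D)
    (hm : 1 ≤ numConstraints C)
    (hmD : (numConstraints C : ℝ) + 1 ≤ D) (hyM : (natTotal y : ℝ) ≤ M)
    (hMD : M ≤ (1 / δ + 2) * D) (hTD : T + D ≤ M) (h : IsImproveOutput C δ α x y x' y') :
    IsSolution C x' ∧ norm1 x' ≤ T - α ∧ IsSolution C (toReal y') ∧
      norm1 (toReal y') ≤ M - α ∧ nnz x' = nnz y' ∧ (nnz y' : ℝ) ≤ D ∧ (∀ P, x' P ≤ y' P) ∧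
      levelsChanged y y' ≤ 29 * ((numConstraints C + α) * (1 + 1 / δ)) := by
  obtain ⟨xhat, yhat, hcov, hopt, hcase, hle1, hle2, htot⟩ := h
  have hnorm := norm1_fixedPart_add_le hδ hα hx hxT hT hcov hopt
  have hδ' : 0 < 1 / δ := by positivity
  have hm' : (1 : ℝ) ≤ numConstraints C := by exact_mod_cast hm
  obtain ⟨hx's, hx'n, hsub, hx'D, hchange⟩ : IsSolution C x' ∧ norm1 x' ≤ T - α ∧
      yhat.support ⊆ x'.support ∧ (nnz x' : ℝ) ≤ D ∧ norm1 (toReal yhat - toReal y) ≤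
        14 * ((numConstraints C + α) * (1 + 1 / δ)) := by
    rcases hcase with ⟨hle, rfl, rfl⟩ | ⟨hlt, S, r, hS, hr, rfl, rfl⟩
    · refine ⟨hx, hle.trans hnorm, ?_, hnnz ▸ hyD, ?_⟩
      · refine (Finset.eq_of_subset_of_card_le (fun P hP => ?_) hnnz.ge).ge
        rw [mem_support_iff] at hP ⊢
        intro h
        have := hxy P
        rw [h, Nat.cast_zero] at this
        exact hP (le_antisymm this (hx.1 P))
      · rw [sub_self, norm1_zero]
        positivity
    · obtain ⟨h1, h2, h3, h4, h5⟩ := improve_replacement hδ hα hx hxy hnnz hyD hmD hyM hMD hcov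
        hlt hS hr
      refine ⟨h1, h2.trans hnorm, h3, h4, h5.trans ?_⟩
      -- since `1 ≤ m`, the bound has at most `14` units `(m + α) (1 + 1 / δ)`
      have hα0 : (0 : ℝ) ≤ α := Nat.cast_nonneg _
      have h6 : 0 ≤ (α : ℝ) * (1 / δ) := by positivity
      have h7 : 0 ≤ ((numConstraints C : ℝ) - 1) * (1 / δ) :=
        mul_nonneg (by linarith) hδ'.le
      nlinarith
  have hsupp : x'.support = y'.support := by
    apply subset_antisymm
    · rw [← support_ceilVec hx's.nonneg]
      exact Finsupp.support_mono hle1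
    · exact (Finsupp.support_mono hle2).trans hsub
  have hnnz' : nnz x' = nnz y' := congrArg Finset.card hsupp
  have hαy : α ≤ natTotal y := by
    have h1 : norm1 x ≤ natTotal y := by
      rw [← norm1_toReal]
      exact norm1_mono hx.nonneg fun P => by simpa using hxy P
    have h2 : (0 : ℝ) ≤ α * (1 / δ) := by positivity
    have h3 : (0 : ℝ) ≤ α := Nat.cast_nonneg _
    have : (α : ℝ) ≤ natTotal y := by linarith
    exact_mod_cast this
  have hsubα : ((natTotal y - α : ℕ) : ℝ) = natTotal y - α := by push_cast [hαy]; rfl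
  have hx'y' := ceilVec_le_iff.1 hle1
  refine ⟨hx's, hx'n, hx's.mono fun P => by simpa using hx'y' P, ?_, hnnz', hnnz' ▸ hx'D, hx'y',
    ?_⟩
  · rw [norm1_toReal, htot, Nat.cast_max]
    refine max_le ?_ ?_
    · linarith [natTotal_ceilVec_le hx's.nonneg]
    · rw [Nat.cast_min, hsubα]
      exact (min_le_right _ _).trans (by linarith)
  · have h1 : min (natTotal yhat : ℝ) (natTotal y - α) ≤ natTotal y' := by
      rw [htot, Nat.cast_max, Nat.cast_min, hsubα]
      exact le_max_right _ _
    have h2 := norm1_toReal_sub hle2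
    have h3 : (natTotal yhat : ℝ) - natTotal y ≤ norm1 (toReal yhat - toReal y) := by
      have h4 := norm1_add_le (toReal yhat - toReal y) (toReal y)
      rw [sub_add_cancel, norm1_toReal, norm1_toReal] at h4
      linarith
    have h4 := norm1_add_le (toReal y' - toReal yhat) (toReal yhat - toReal y)
    rw [sub_add_sub_cancel, norm1_sub_comm (toReal y') (toReal yhat), h2] at h4
    have h5 : (α : ℝ) ≤ (numConstraints C + α) * (1 + 1 / δ) := by
      have : (0 : ℝ) ≤ (numConstraints C + α) * (1 / δ) := by positivity
      linarith
    have h6 : norm1 (toReal yhat - toReal y) ≥ 0 := norm1_nonneg _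
    rw [levelsChanged]
    -- the final reduction removes at most `‖ŷ‖ - ‖y‖`, which is at most `14` units, and `α`
    rcases min_le_iff.1 h1 with h | h <;> linarith

end Improve

/-! ### Slicing a strip packing -/

section Slices

open scoped Classical in
/-- A strip packing of height `H` as a fractional covering of the items by sets of items that fit
next to each other: the weight of a set `T` is the measure of the heights at which exactly the
items of `T` are cut by a horizontal line. -/
lemma LargeInstance.IsPacking.exists_slices {ε : ℝ} {ι : Type*} [Fintype ι]
    {I : LargeInstance ε ι} {H : ℝ} {p : ι → ℝ × ℝ} (hp : I.IsPacking H p) (hε : 0 < ε)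
    (hH : 0 ≤ H) :
    ∃ μ : Finset ι → ℝ, (∀ T, 0 ≤ μ T) ∧ ∑ T, μ T = H ∧
      (∀ i, ∑ T with i ∈ T, μ T = I.h i) ∧ ∀ T, μ T ≠ 0 → ∑ i ∈ T, I.w i ≤ 1 := by
  let J : ι → Set ℝ := fun i => Set.Ico (p i).2 ((p i).2 + I.h i)
  let E : Finset ι → Set ℝ := fun T => Set.Ico 0 H ∩ {t | ∀ i, i ∈ T ↔ t ∈ J i}
  have hmeas : ∀ T, MeasurableSet (E T) := by
    intro T
    refine measurableSet_Ico.inter ?_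
    rw [Set.ofPred_forall]
    refine MeasurableSet.iInter fun i => ?_
    by_cases hi : i ∈ T
    · have : {t | i ∈ T ↔ t ∈ J i} = J i := by ext; simp [hi]
      rw [this]
      exact measurableSet_Ico
    · have : {t | i ∈ T ↔ t ∈ J i} = (J i)ᶜ := by ext; simp [hi]
      rw [this]
      exact measurableSet_Ico.compl
  have hdisj : ∀ 𝒯 : Finset (Finset ι), (𝒯 : Set (Finset ι)).PairwiseDisjoint E := by
    intro 𝒯 T _ T' _ hne
    refine Set.disjoint_left.2 fun t ht ht' => hne (Finset.ext fun i => ?_)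
    exact (ht.2 i).trans (ht'.2 i).symm
  have hfin : ∀ T, MeasureTheory.volume (E T) ≠ ⊤ := fun T =>
    ((MeasureTheory.measure_mono Set.inter_subset_left).trans_lt measure_Ico_lt_top).ne
  have hsum : ∀ 𝒯 : Finset (Finset ι), ∑ T ∈ 𝒯, MeasureTheory.volume.real (E T) =
      MeasureTheory.volume.real (⋃ T ∈ 𝒯, E T) := fun 𝒯 =>
    (MeasureTheory.measureReal_biUnion_finset (hdisj 𝒯) (fun T _ => hmeas T)
      (fun T _ => hfin T)).symm
  have hactive : ∀ t ∈ Set.Ico 0 H, t ∈ E (Finset.univ.filter fun i => t ∈ J i) := fun t ht =>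
    ⟨ht, fun i => by simp⟩
  refine ⟨fun T => MeasureTheory.volume.real (E T), fun T => MeasureTheory.measureReal_nonneg,
    ?_, fun i => ?_, fun T hT => ?_⟩
  · rw [hsum]
    have : (⋃ T ∈ (Finset.univ : Finset (Finset ι)), E T) = Set.Ico 0 H := by
      ext t
      simp only [Finset.mem_univ, Set.iUnion_true, Set.mem_iUnion]
      exact ⟨fun ⟨T, hT⟩ => hT.1, fun ht => ⟨_, hactive t ht⟩⟩
    rw [this]
    simp [hH]
  · rw [hsum]
    have : (⋃ T ∈ Finset.univ.filter fun T : Finset ι => i ∈ T, E T) = J i := by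
      ext t
      simp only [Finset.mem_filter, Finset.mem_univ, true_and, Set.mem_iUnion, exists_prop]
      refine ⟨fun ⟨T, hi, hT⟩ => (hT.2 i).1 hi, fun ht => ?_⟩
      have htH : t ∈ Set.Ico 0 H :=
        ⟨(hp.1 i).2.2.1.trans ht.1, ht.2.trans_le (hp.1 i).2.2.2⟩
      exact ⟨_, by simpa using ht, hactive t htH⟩
    rw [this]
    simp [J, (I.h_pos i).le]
  · obtain ⟨t, ht⟩ : (E T).Nonempty := by
      rw [Set.nonempty_iff_ne_empty]
      intro h
      simp [h] at hT
    have hw : ∀ i, 0 ≤ I.w i := fun i => hε.le.trans (I.le_w i)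
    have hd : (T : Set ι).PairwiseDisjoint
        fun i => Set.Ico (p i).1 ((p i).1 + I.w i) := by
      intro i hi j hj hne
      have hti := (ht.2 i).1 hi
      have htj := (ht.2 j).1 hj
      refine Set.disjoint_left.2 fun s hs hs' => ?_
      rcases hp.2 i j hne with h | h | h | h
      · exact absurd (hs.2.trans_le (h.trans hs'.1)) (lt_irrefl _)
      · exact absurd (hs'.2.trans_le (h.trans hs.1)) (lt_irrefl _)
      · exact absurd (hti.2.trans_le (h.trans htj.1)) (lt_irrefl _)
      · exact absurd (htj.2.trans_le (h.trans hti.1)) (lt_irrefl _)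
    have hsub : (⋃ i ∈ T, Set.Ico (p i).1 ((p i).1 + I.w i)) ⊆ Set.Ico 0 1 :=
      Set.iUnion₂_subset fun i _ => Set.Ico_subset_Ico (hp.1 i).1 (hp.1 i).2.1
    calc ∑ i ∈ T, I.w i
        = ∑ i ∈ T, MeasureTheory.volume.real (Set.Ico (p i).1 ((p i).1 + I.w i)) :=
          Finset.sum_congr rfl fun i _ => by simp [hw i]
      _ = MeasureTheory.volume.real (⋃ i ∈ T, Set.Ico (p i).1 ((p i).1 + I.w i)) :=
          (MeasureTheory.measureReal_biUnion_finset hd (fun i _ => measurableSet_Ico)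
            (fun i _ => measure_Ico_lt_top.ne)).symm
      _ ≤ MeasureTheory.volume.real (Set.Ico (0 : ℝ) 1) :=
          MeasureTheory.measureReal_mono hsub measure_Ico_lt_top.ne
      _ = 1 := by simp

open scoped Classical in
lemma LargeInstance.IsPacking.size_le {ε : ℝ} {ι : Type*} [Fintype ι]
    {I : LargeInstance ε ι} {H : ℝ} {p : ι → ℝ × ℝ} (hp : I.IsPacking H p) (hε : 0 < ε)
    (hH : 0 ≤ H) : I.size ≤ H := by
  obtain ⟨μ, hμ0, hμH, hμh, hμw⟩ := hp.exists_slices hε hH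
  calc I.size = ∑ i, ∑ T with i ∈ T, I.w i * μ T :=
        Finset.sum_congr rfl fun i _ => by rw [← hμh i, Finset.mul_sum]
    _ = ∑ T, ∑ i ∈ T, I.w i * μ T := Finset.sum_comm' fun i T => by simp
    _ ≤ ∑ T, μ T := Finset.sum_le_sum fun T _ => by
        rw [← Finset.sum_mul]
        by_cases h : μ T = 0
        · simp [h]
        · exact mul_le_of_le_one_left (hμ0 T) (hμw T h)
    _ = H := hμH

/-- The items can be stacked, one above the other. -/
lemma LargeInstance.exists_isPacking {ε : ℝ} {ι : Type*} [Fintype ι] (I : LargeInstance ε ι) :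
    ∃ H, 0 ≤ H ∧ ∃ p, I.IsPacking H p := by
  have h1 : ∀ i, (0 : ℝ) ≤ Fintype.equivFin ι i := fun i => Nat.cast_nonneg _
  have h2 : ∀ i, (Fintype.equivFin ι i : ℝ) + 1 ≤ Fintype.card ι := fun i => by
    exact_mod_cast (Fintype.equivFin ι i).isLt
  refine ⟨Fintype.card ι, by positivity, fun i => (0, (Fintype.equivFin ι i : ℕ)),
    fun i => ⟨le_rfl, by simpa using I.w_le i, h1 i, by linarith [h2 i, I.h_le i]⟩,
    fun i j hij => ?_⟩
  have hne : (Fintype.equivFin ι i : ℕ) ≠ Fintype.equivFin ι j := fun h =>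
    hij ((Fintype.equivFin ι).injective (Fin.ext h))
  rcases lt_or_gt_of_ne hne with h | h
  · have : (Fintype.equivFin ι i : ℝ) + 1 ≤ Fintype.equivFin ι j := by exact_mod_cast h
    exact Or.inr (Or.inr (Or.inl (by linarith [I.h_le i])))
  · have : (Fintype.equivFin ι j : ℝ) + 1 ≤ Fintype.equivFin ι i := by exact_mod_cast h
    exact Or.inr (Or.inr (Or.inr (by linarith [I.h_le j])))

lemma LargeInstance.opt_nonneg {ε : ℝ} {ι : Type*} (I : LargeInstance ε ι) : 0 ≤ I.opt :=
  Real.sInf_nonneg fun _ hH => hH.1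

open scoped Classical in
/-- In a fractional covering of items by sets of width at most `1`, the items of pairwise disjoint
sets `N g` are replaced by objects of smaller width `W g`. -/
lemma exists_coverage_of_slices {ι γ : Type*} [Fintype ι] {C : Multiset ℝ} {w h : ι → ℝ}
    {μ : Finset ι → ℝ} {c : ℝ} (hc : 0 ≤ c) (hw : ∀ i, 0 ≤ w i) (hμ : ∀ T, 0 ≤ μ T)
    (hμh : ∀ i, ∑ T with i ∈ T, μ T = h i) (hμw : ∀ T, μ T ≠ 0 → ∑ i ∈ T, w i ≤ 1)
    (s : Finset γ) (N : γ → Finset ι) (hN : (s : Set γ).PairwiseDisjoint N) (W : γ → ℝ)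
    (hWC : ∀ g ∈ s, W g ∈ C) (hW : ∀ g ∈ s, ∀ i ∈ N g, W g ≤ w i) :
    ∃ x : Pattern C →₀ ℝ, 0 ≤ x ∧ norm1 x = c * ∑ T, μ T ∧
      ∀ v, coverage x v = ∑ g ∈ s with W g = v, c * ∑ i ∈ N g, h i := by
  let P : Finset ι → Multiset ℝ := fun T =>
    ∑ g ∈ s, Multiset.replicate (N g ∩ T).card (W g)
  have hPmem : ∀ T, ∀ v ∈ P T, v ∈ C := by
    intro T v hv
    obtain ⟨g, hg, hvg⟩ := Multiset.mem_sum.1 hv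
    rw [Multiset.eq_of_mem_replicate hvg]
    exact hWC g hg
  have hPsum : ∀ T, ∑ i ∈ T, w i ≤ 1 → (P T).sum ≤ 1 := by
    intro T hT
    refine le_trans ?_ hT
    have hd : (s : Set γ).PairwiseDisjoint fun g => N g ∩ T := fun g hg g' hg' hne =>
      (hN hg hg' hne).mono Finset.inter_subset_left Finset.inter_subset_left
    calc (P T).sum = ∑ g ∈ s, ((N g ∩ T).card • W g) := by
          simp only [P, Multiset.sum_sum, Multiset.sum_replicate]
      _ ≤ ∑ g ∈ s, ∑ i ∈ N g ∩ T, w i := Finset.sum_le_sum fun g hg =>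
          Finset.card_nsmul_le_sum _ _ _ fun i hi => hW g hg i (Finset.mem_inter.1 hi).1
      _ = ∑ i ∈ s.biUnion fun g => N g ∩ T, w i := (Finset.sum_biUnion hd).symm
      _ ≤ ∑ i ∈ T, w i := Finset.sum_le_sum_of_subset_of_nonneg
          (Finset.biUnion_subset.2 fun g _ => Finset.inter_subset_right) fun i _ _ => hw i
  have hcount : ∀ T v, (P T).count v = ∑ g ∈ s with W g = v, (N g ∩ T).card := by
    intro T v
    simp only [P, Multiset.count_sum', Multiset.count_replicate, Finset.sum_filter]
  -- sets that are too wide have weight `0`, their pattern is irrelevant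
  let Q : Finset ι → Pattern C := fun T =>
    if hT : ∑ i ∈ T, w i ≤ 1 then ⟨P T, hPmem T, hPsum T hT⟩ else ⟨0, by simp⟩
  have hx0 : 0 ≤ ∑ T, single (Q T) (c * μ T) :=
    Finset.sum_nonneg fun T _ => single_nonneg.2 (mul_nonneg hc (hμ T))
  refine ⟨∑ T, single (Q T) (c * μ T), hx0, ?_, fun v => ?_⟩
  · rw [norm1_eq_linearCombination hx0, Finset.mul_sum, map_sum]
    simp only [linearCombination_single, smul_eq_mul, mul_one]
  · have h1 : ∀ T, c * μ T * ((Q T).1.count v : ℝ) =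
        ∑ g ∈ s with W g = v, ∑ i ∈ N g with i ∈ T, c * μ T := by
      intro T
      by_cases h0 : μ T = 0
      · simp [h0]
      · simp only [Q, dif_pos (hμw T h0), hcount, Finset.sum_const, nsmul_eq_mul,
          ← Finset.sum_mul, Finset.filter_mem_eq_inter]
        push_cast
        ring
    simp only [coverage_sum, coverage_single, h1]
    rw [Finset.sum_comm]
    refine Finset.sum_congr rfl fun g _ => ?_
    rw [Finset.mul_sum]
    calc ∑ T, ∑ i ∈ N g with i ∈ T, c * μ T = ∑ i ∈ N g, ∑ T with i ∈ T, c * μ T :=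
          Finset.sum_comm' fun T i => by simp [and_comm]
      _ = ∑ i ∈ N g, c * h i := Finset.sum_congr rfl fun i _ => by
          rw [← Finset.mul_sum, hμh i]

end Slices

/-! ### Groups of containers -/

section Rounding

variable {ε : ℝ} {ι κ : Type*} {I : LargeInstance ε ι} {con : ι → κ}
  {R : κ → WidthGroup}

/-- The width to which the containers of a group are rounded. -/
noncomputable def groupWidth (I : LargeInstance ε ι) (con : ι → κ) (R : κ → WidthGroup)
    (g : WidthGroup) : ℝ :=
  ⨆ c : {c : κ // R c = g}, containerWidth I con c

lemma groupWidth_le {g : WidthGroup} {a : ℝ} (ha : 0 ≤ a)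
    (h : ∀ i, R (con i) = g → I.w i ≤ a) : groupWidth I con R g ≤ a :=
  Real.iSup_le (fun c => Real.iSup_le (fun i => h i (by rw [i.2, c.2])) ha) ha

/-- The groups whose containers are packed separately: their left neighbour may be smaller than
themselves or may not exist. -/
def IsLeading (g : WidthGroup) : Prop := g.pos = 0 ∨ g.block = Block.A ∧ g.pos = 1

/-- The group of the preceding position in the same block (for a positive position). -/
def WidthGroup.prev (g : WidthGroup) : WidthGroup := ⟨g.cat, g.block, g.pos - 1⟩

lemma prev_injOn : Set.InjOn WidthGroup.prev {g | ¬ IsLeading g} := by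
  rintro ⟨l, X, r⟩ hg ⟨l', X', r'⟩ hg' h
  simp only [IsLeading, not_or, Set.mem_ofPred_eq] at hg hg'
  simp only [WidthGroup.prev, WidthGroup.mk.injEq] at h ⊢
  exact ⟨h.1, h.2.1, by omega⟩

lemma isLeftOf_prev {g : WidthGroup} (hg : ¬ IsLeading g) : IsLeftOf R g.prev g := by
  simp only [IsLeading, not_or] at hg
  exact ⟨rfl, Or.inl ⟨rfl, Nat.sub_add_cancel (Nat.pos_of_ne_zero hg.1)⟩⟩

variable [Fintype ι]

lemma le_containerWidth (i : ι) : I.w i ≤ containerWidth I con (con i) :=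
  le_ciSup (f := fun j : {j : ι // con j = con i} => I.w j) (Set.finite_range _).bddAbove ⟨i, rfl⟩

lemma mem_roundedInstance {v : ℝ} :
    v ∈ roundedInstance I con R ↔ ∃ i, groupWidth I con R (R (con i)) = v := by
  simp [roundedInstance, roundedWidth, groupWidth]

open scoped Classical in
/-- The groups that contain items. -/
noncomputable def usedGroups (con : ι → κ) (R : κ → WidthGroup) : Finset WidthGroup :=
  Finset.univ.image fun i => R (con i)

lemma mem_usedGroups {g : WidthGroup} : g ∈ usedGroups con R ↔ ∃ i, R (con i) = g := by
  simp [usedGroups]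

open scoped Classical in
lemma numConstraints_roundedInstance_le :
    numConstraints (roundedInstance I con R) ≤ (usedGroups con R).card := by
  refine (Finset.card_le_card (t := (usedGroups con R).image (groupWidth I con R))
    fun v hv => ?_).trans Finset.card_image_le
  obtain ⟨i, hi⟩ := mem_roundedInstance.1 (Multiset.mem_toFinset.1 hv)
  exact Finset.mem_image.2 ⟨_, mem_usedGroups.2 ⟨i, rfl⟩, hi⟩

lemma Invariant.isCategory (hR : Invariant I con R) (i : ι) :
    IsCategory I con (R (con i)).cat := by
  refine ⟨con i, (hR.categories i).1.trans_le (le_containerWidth i),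
    Real.iSup_le (fun j => ?_) (by positivity)⟩
  have := (hR.categories j.1).2
  rwa [j.2] at this

lemma Invariant.cat_lt (hR : Invariant I con R) (hε : 0 < ε) (i : ι) :
    (R (con i)).cat < numCategories ε := by
  refine Nat.lt_succ_of_le (Nat.le_floor ?_)
  rw [Real.le_logb_iff_rpow_le (by norm_num) (by positivity), Real.rpow_natCast,
    le_div_iff₀ hε, ← le_div_iff₀' (by positivity)]
  have := (I.le_w i).trans (hR.categories i).2
  rwa [one_div_pow] at this

variable [Fintype κ]

lemma le_groupWidth (i : ι) : I.w i ≤ groupWidth I con R (R (con i)) :=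
  (le_containerWidth i).trans (le_ciSup
    (f := fun c : {c : κ // R c = R (con i)} => containerWidth I con c)
    (Set.finite_range _).bddAbove ⟨con i, rfl⟩)

open scoped Classical in
lemma groupCard_eq_card_filter (g : WidthGroup) :
    groupCard R g = (Finset.univ.filter fun c => R c = g).card := by
  rw [groupCard, Nat.card_eq_fintype_card, Fintype.card_subtype]

open scoped Classical in
lemma demand_roundedInstance_le (v : ℝ) : demand (roundedInstance I con R) v ≤
    ∑ g ∈ usedGroups con R with groupWidth I con R g = v, (groupCard R g : ℝ) := by
  rw [demand, roundedInstance, Multiset.count_map]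
  have h1 : ((Finset.univ.image con).filter fun c => v = roundedWidth I con R c) ⊆
      ((usedGroups con R).filter fun g => groupWidth I con R g = v).biUnion
        fun g => Finset.univ.filter fun c => R c = g := by
    intro c hc
    simp only [Finset.mem_filter, Finset.mem_image, Finset.mem_univ, true_and] at hc
    obtain ⟨⟨i, rfl⟩, hv⟩ := hc
    simp only [Finset.mem_biUnion, Finset.mem_filter, Finset.mem_univ, true_and]
    exact ⟨_, ⟨mem_usedGroups.2 ⟨i, rfl⟩, hv.symm⟩, rfl⟩
  have h2 := (Finset.card_le_card h1).trans Finset.card_biUnion_le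
  simp only [← groupCard_eq_card_filter] at h2
  exact_mod_cast h2

lemma exists_isLastPos {l r : ℕ} {X : Block} (h : ∃ c, R c = ⟨l, X, r⟩) :
    ∃ q, IsLastPos R l X q ∧ r ≤ q := by
  classical
  obtain ⟨c, hc⟩ := h
  obtain ⟨d, hd, hmax⟩ := Finset.exists_max_image
    (Finset.univ.filter fun c => (R c).cat = l ∧ (R c).block = X) (fun c => (R c).pos)
    ⟨c, by simp [hc]⟩
  simp only [Finset.mem_filter, Finset.mem_univ, true_and] at hd hmax
  refine ⟨(R d).pos, ⟨⟨d, ?_⟩, ?_⟩, ?_⟩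
  · rw [← hd.1, ← hd.2]
  · rintro r' ⟨c', hc'⟩
    simpa [hc'] using hmax c' (by simp [hc'])
  · simpa [hc] using hmax c (by simp [hc])

lemma Invariant.groupCard_le_of_isLeading (hR : Invariant I con R) {i : ι}
    (hi : IsLeading (R (con i))) :
    (groupCard R (R (con i)) : ℝ) ≤ 2 ^ (R (con i)).cat * blockParam I := by
  have hcat := hR.isCategory i
  obtain ⟨q, hq, hle⟩ := exists_isLastPos (R := R) (l := (R (con i)).cat)
    (X := (R (con i)).block) (r := (R (con i)).pos) ⟨con i, rfl⟩
  have hk' : (2 : ℝ) ^ (R (con i)).cat * ((blockParam I : ℝ) - 1) ≤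
      2 ^ (R (con i)).cat * blockParam I := by gcongr; linarith
  generalize R (con i) = g at *
  obtain ⟨l, X, r⟩ := g
  cases X with
  | A =>
    simp only [IsLeading, true_and] at hi
    rcases hi with h | h <;> subst h
    · exact_mod_cast hR.blockA_first l hcat
    · exact_mod_cast (hR.blockA l hcat q hq 1 le_rfl hle).le
  | B =>
    simp only [IsLeading, reduceCtorEq, false_and, or_false] at hi
    subst hi
    refine le_trans ?_ hk'
    rcases hle.eq_or_lt with h | h
    · obtain rfl : 0 = q := h
      exact hR.blockB_last l hcat 0 hq
    · exact (hR.blockB l hcat q hq 0 h).le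

lemma Invariant.groupCard_prev (hR : Invariant I con R) {i : ι} (hi : ¬ IsLeading (R (con i))) :
    (groupCard R (R (con i)) : ℝ) ≤ groupCard R (R (con i)).prev ∧
      2 ^ (R (con i)).cat * ((blockParam I : ℝ) - 1) ≤ groupCard R (R (con i)).prev := by
  have hcat := hR.isCategory i
  obtain ⟨q, hq, hle⟩ := exists_isLastPos (R := R) (l := (R (con i)).cat)
    (X := (R (con i)).block) (r := (R (con i)).pos) ⟨con i, rfl⟩
  generalize R (con i) = g at *
  obtain ⟨l, X, r⟩ := g
  cases X with
  | A =>
    simp only [IsLeading, true_and, not_or] at hi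
    dsimp only at hle hcat hq
    have h1 := hR.blockA l hcat q hq r (by omega) hle
    have h2 := hR.blockA l hcat q hq (r - 1) (by omega) (by omega)
    simp only [WidthGroup.prev, h1, h2, le_refl, true_and]
    push_cast
    gcongr
    linarith
  | B =>
    simp only [IsLeading, reduceCtorEq, false_and, or_false] at hi
    dsimp only at hle hcat hq
    have h2 := hR.blockB l hcat q hq (r - 1) (by omega)
    simp only [WidthGroup.prev, h2, le_refl, and_true]
    rcases hle.eq_or_lt with h | h
    · exact h ▸ hR.blockB_last l hcat q hq
    · exact (hR.blockB l hcat q hq r h).le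

/-! ### Estimates of the parameters -/

lemma le_containerHeight (hε : 0 < ε) (hε4 : ε ≤ 1 / 4) : 208 ≤ containerHeight ε := by
  rw [containerHeight, le_div_iff₀ (by positivity)]
  nlinarith

lemma numCategories_le (hε : 0 < ε) (hε4 : ε ≤ 1 / 4) : (numCategories ε : ℝ) ≤ 1 / ε := by
  have h1 : (1 : ℝ) ≤ 1 / ε := by rw [le_div_iff₀ hε]; linarith
  have h2 : ((⌊Real.logb 2 (1 / ε)⌋₊ : ℕ) : ℝ) ≤ Real.logb 2 (1 / ε) :=
    Nat.floor_le (Real.logb_nonneg (by norm_num) h1)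
  rw [Real.le_logb_iff_rpow_le (by norm_num) (by positivity), Real.rpow_natCast] at h2
  refine le_trans ?_ h2
  exact_mod_cast Nat.lt_two_pow_self

/-- All estimates of the parameter `k` that are needed, in terms of the unrounded value. -/
lemma blockParam_bounds (hε : 0 < ε) (hε4 : ε ≤ 1 / 4)
    (hsize : 4 * numCategories ε * containerHeight ε / ε * (containerHeight ε + 1) ≤ I.size) :
    0 < I.size ∧ containerHeight ε ≤ blockParam I ∧
      numCategories ε * (blockParam I : ℝ) ≤ ε * I.size / (4 * containerHeight ε) ∧
      ε * I.size / (8 * numCategories ε) ≤ containerHeight ε * ((blockParam I : ℝ) - 1) := by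
  have hB := le_containerHeight hε hε4
  have hω : (0 : ℝ) < numCategories ε := by
    rw [numCategories]; positivity
  rw [blockParam]
  set h := containerHeight ε
  set ω : ℝ := ((numCategories ε : ℕ) : ℝ)
  have hq : 0 < ε / (4 * ω * h) := by positivity
  have hs : h + 1 ≤ ε / (4 * ω * h) * I.size := by
    have := mul_le_mul_of_nonneg_left hsize hq.le
    rwa [← mul_assoc, div_mul_div_cancel₀ (by positivity), div_self hε.ne', one_mul] at this
  have hfl := Nat.floor_le (a := ε / (4 * ω * h) * I.size) (by linarith)
  have hfl' := Nat.sub_one_lt_floor (ε / (4 * ω * h) * I.size)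
  have heq : ε / (4 * ω * h) * I.size * (ω * h) = ε * I.size / 4 := by
    field_simp
  refine ⟨?_, by linarith, ?_, ?_⟩
  · exact pos_of_mul_pos_right (by linarith) hq.le
  · calc ω * (⌊ε / (4 * ω * h) * I.size⌋₊ : ℝ) ≤ ω * (ε / (4 * ω * h) * I.size) := by gcongr
      _ = ε * I.size / (4 * h) := by field_simp
  · calc ε * I.size / (8 * ω) = h * (ε / (4 * ω * h) * I.size / 2) := by
          field_simp
          ring
      _ ≤ h * ((⌊ε / (4 * ω * h) * I.size⌋₊ : ℝ) - 1) := by gcongr; linarith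

/-- The left neighbour of a non-leading group has at least `h_B - 1` containers, so that the
container that may be missing in the invariant on heights costs only one more unit of height per
container. -/
lemma Invariant.le_groupHeight_prev (hR : Invariant I con R) (hε : 0 < ε) (hε4 : ε ≤ 1 / 4)
    (hk : containerHeight ε ≤ blockParam I) {i : ι} (hi : ¬ IsLeading (R (con i))) :
    (containerHeight ε - 2) * groupCard R (R (con i)).prev ≤
      groupHeight I con R (R (con i)).prev := by
  have hB := le_containerHeight hε hε4
  obtain ⟨-, h2⟩ := hR.groupCard_prev hi
  have h3 := (hR.height (R (con i)).prev).1
  have h4 : (blockParam I : ℝ) - 1 ≤ 2 ^ (R (con i)).cat * ((blockParam I : ℝ) - 1) :=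
    le_mul_of_one_le_left (by linarith) (one_le_pow₀ (by norm_num))
  nlinarith

lemma Invariant.groupCard_le_groupHeight_prev (hR : Invariant I con R) (hε : 0 < ε)
    (hε4 : ε ≤ 1 / 4) (hk : containerHeight ε ≤ blockParam I) {i : ι}
    (hi : ¬ IsLeading (R (con i))) :
    (groupCard R (R (con i)) : ℝ) ≤
      (1 + ε) / containerHeight ε * groupHeight I con R (R (con i)).prev := by
  have hB := le_containerHeight hε hε4
  have h1 := hR.le_groupHeight_prev hε hε4 hk hi
  have h2 : 52 ≤ ε * containerHeight ε := by
    rw [containerHeight, mul_div_assoc', le_div_iff₀ (by positivity)]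
    nlinarith
  have h3 : 1 ≤ (1 + ε) / containerHeight ε * (containerHeight ε - 2) := by
    rw [div_mul_eq_mul_div, le_div_iff₀ (by linarith)]
    nlinarith
  calc (groupCard R (R (con i)) : ℝ) ≤ groupCard R (R (con i)).prev := (hR.groupCard_prev hi).1
    _ ≤ (1 + ε) / containerHeight ε * (containerHeight ε - 2) * groupCard R (R (con i)).prev :=
        le_mul_of_one_le_left (Nat.cast_nonneg _) h3
    _ = (1 + ε) / containerHeight ε * ((containerHeight ε - 2) * groupCard R (R (con i)).prev) :=
        mul_assoc _ _ _
    _ ≤ _ := by gcongr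

open scoped Classical in
/-- The number of groups is `O(1 / ε ^ 2)`: the left neighbours of the non-leading groups all have
large area. -/
lemma Invariant.card_usedGroups_le (hR : Invariant I con R) (hε : 0 < ε) (hε4 : ε ≤ 1 / 4)
    (hsize : 4 * numCategories ε * containerHeight ε / ε * (containerHeight ε + 1) ≤ I.size) :
    ((usedGroups con R).filter IsLeading).card ≤ 3 * numCategories ε ∧
      (((usedGroups con R).filter fun g => ¬ IsLeading g).card : ℝ) ≤ 32 / ε ^ 2 := by
  have hB := le_containerHeight hε hε4
  obtain ⟨hpos, hk, -, hk'⟩ := blockParam_bounds hε hε4 hsize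
  constructor
  · have hsub : (usedGroups con R).filter IsLeading ⊆ (Finset.range (numCategories ε)).biUnion
        fun l => {⟨l, Block.A, 0⟩, ⟨l, Block.A, 1⟩, ⟨l, Block.B, 0⟩} := by
      intro g hg
      rw [Finset.mem_filter, mem_usedGroups] at hg
      obtain ⟨⟨i, rfl⟩, hg⟩ := hg
      have hlt := hR.cat_lt hε i
      generalize R (con i) = g at *
      obtain ⟨l, X, r⟩ := g
      simp only [Finset.mem_biUnion, Finset.mem_range, Finset.mem_insert, Finset.mem_singleton,
        WidthGroup.mk.injEq]
      refine ⟨l, hlt, ?_⟩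
      cases X <;> simpa [IsLeading] using hg
    refine (Finset.card_le_card hsub).trans ((Finset.card_biUnion_le_card_mul _ _ 3
      fun l _ => Finset.card_le_three).trans ?_)
    rw [Finset.card_range, mul_comm]
  · have hω : (0 : ℝ) < numCategories ε := by rw [numCategories]; positivity
    let N : WidthGroup → Finset ι := fun g => Finset.univ.filter fun i => R (con i) = g.prev
    have harea : ∀ g ∈ (usedGroups con R).filter fun g => ¬ IsLeading g,
        ε * I.size / (32 * numCategories ε) ≤ ∑ i ∈ N g, I.w i * I.h i := by
      intro g hg
      rw [Finset.mem_filter, mem_usedGroups] at hg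
      obtain ⟨⟨j, rfl⟩, hg⟩ := hg
      have h1 := hR.le_groupHeight_prev hε hε4 hk hg
      have h2 := (hR.groupCard_prev hg).2
      set l := (R (con j)).cat
      calc ε * I.size / (32 * numCategories ε) = ε * I.size / (8 * numCategories ε) / 4 := by
            field_simp; norm_num
        _ ≤ (containerHeight ε - 2) * ((blockParam I : ℝ) - 1) / 2 := by nlinarith
        _ = (1 / 2 : ℝ) ^ (l + 1) * ((containerHeight ε - 2) *
              (2 ^ l * ((blockParam I : ℝ) - 1))) := by
            rw [pow_succ, one_div_pow]; field_simp
        _ ≤ (1 / 2 : ℝ) ^ (l + 1) * groupHeight I con R (R (con j)).prev := by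
            gcongr
            exact le_trans (mul_le_mul_of_nonneg_left h2 (by linarith)) h1
        _ = ∑ i ∈ N (R (con j)), (1 / 2 : ℝ) ^ (l + 1) * I.h i := by
            rw [groupHeight, Finset.mul_sum]
        _ ≤ ∑ i ∈ N (R (con j)), I.w i * I.h i := by
            refine Finset.sum_le_sum fun i hi => mul_le_mul_of_nonneg_right ?_ (I.h_pos i).le
            have h3 := (hR.categories i).1.le
            rwa [(Finset.mem_filter.1 hi).2] at h3
    have hd : ((usedGroups con R).filter fun g => ¬ IsLeading g : Set WidthGroup).PairwiseDisjoint
        N := by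
      intro g hg g' hg' hne
      refine Finset.disjoint_left.2 fun i hi hi' => hne ?_
      exact prev_injOn (Finset.mem_filter.1 hg).2 (Finset.mem_filter.1 hg').2
        ((Finset.mem_filter.1 hi).2.symm.trans (Finset.mem_filter.1 hi').2)
    have htotal : (((usedGroups con R).filter fun g => ¬ IsLeading g).card : ℝ) *
        (ε * I.size / (32 * numCategories ε)) ≤ I.size := by
      rw [← nsmul_eq_mul]
      refine (Finset.card_nsmul_le_sum _ _ _ harea).trans ?_
      rw [← Finset.sum_biUnion hd]
      exact Finset.sum_le_sum_of_subset_of_nonneg (Finset.subset_univ _)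
        fun i _ _ => mul_nonneg (hε.le.trans (I.le_w i)) (I.h_pos i).le
    have hcard : (((usedGroups con R).filter fun g => ¬ IsLeading g).card : ℝ) ≤
        32 * numCategories ε / ε := by
      rw [mul_div_assoc', div_le_iff₀ (by positivity)] at htotal
      rw [le_div_iff₀ hε]
      refine le_of_mul_le_mul_right ?_ hpos
      linarith
    calc _ ≤ 32 * numCategories ε / ε := hcard
      _ ≤ 32 * (1 / ε) / ε := by gcongr; exact numCategories_le hε hε4
      _ = 32 / ε ^ 2 := by field_simp

lemma Invariant.numConstraints_add_one_le (hR : Invariant I con R) (hε : 0 < ε) (hε4 : ε ≤ 1 / 4)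
    (hsize : 4 * numCategories ε * containerHeight ε / ε * (containerHeight ε + 1) ≤ I.size) :
    (numConstraints (roundedInstance I con R) : ℝ) + 1 ≤ 36 / ε ^ 4 := by
  classical
  obtain ⟨h1, h2⟩ := hR.card_usedGroups_le hε hε4 hsize
  have h3 := numConstraints_roundedInstance_le (I := I) (con := con) (R := R)
  rw [← Finset.card_filter_add_card_filter_not (s := usedGroups con R) IsLeading] at h3
  have h4 : (numConstraints (roundedInstance I con R) : ℝ) ≤ 3 * numCategories ε + 32 / ε ^ 2 := by
    have h5 : (numConstraints (roundedInstance I con R) : ℝ) ≤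
        ((usedGroups con R).filter IsLeading).card +
          ((usedGroups con R).filter fun g => ¬ IsLeading g).card := by exact_mod_cast h3
    have h6 : (((usedGroups con R).filter IsLeading).card : ℝ) ≤ 3 * numCategories ε := by
      exact_mod_cast h1
    linarith
  have h5 := numCategories_le hε hε4
  have ht : (1 : ℝ) ≤ 1 / ε := by rw [le_div_iff₀ hε]; linarith
  have h6 : 1 / ε ≤ (1 / ε) ^ 4 := le_self_pow₀ ht (by norm_num)
  have h7 : (1 / ε) ^ 2 ≤ (1 / ε) ^ 4 := pow_le_pow_right₀ ht (by norm_num)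
  have h8 : 36 / ε ^ 4 = 36 * (1 / ε) ^ 4 := by field_simp
  have h9 : 32 / ε ^ 2 = 32 * (1 / ε) ^ 2 := by field_simp
  linarith

/-! ### The rounded container instance -/

/-- Containers of category `l` are packed separately, `2 ^ l` of them on a level. -/
lemma Invariant.exists_coverage_of_isLeading (hR : Invariant I con R) {i : ι}
    (hi : IsLeading (R (con i))) :
    ∃ x : Pattern (roundedInstance I con R) →₀ ℝ, 0 ≤ x ∧ norm1 x ≤ blockParam I ∧
      ∀ v, coverage x v =
        if groupWidth I con R (R (con i)) = v then (groupCard R (R (con i)) : ℝ) else 0 := by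
  have hK := hR.groupCard_le_of_isLeading hi
  have hwidth : groupWidth I con R (R (con i)) ≤ (1 / 2 : ℝ) ^ (R (con i)).cat :=
    groupWidth_le (by positivity) fun j hj => hj ▸ (hR.categories j).2
  have hmem : groupWidth I con R (R (con i)) ∈ roundedInstance I con R :=
    mem_roundedInstance.2 ⟨i, rfl⟩
  set g := R (con i)
  let P : Pattern (roundedInstance I con R) :=
    ⟨Multiset.replicate (2 ^ g.cat) (groupWidth I con R g),
      fun w hw => Multiset.eq_of_mem_replicate hw ▸ hmem, by
        rw [Multiset.sum_replicate, nsmul_eq_mul]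
        calc ((2 ^ g.cat : ℕ) : ℝ) * groupWidth I con R g
            ≤ (2 ^ g.cat : ℕ) * (1 / 2 : ℝ) ^ g.cat := by gcongr
          _ = 1 := by rw [one_div_pow]; push_cast; field_simp⟩
  have h0 : (0 : ℝ) ≤ groupCard R g / 2 ^ g.cat := by positivity
  refine ⟨single P (groupCard R g / 2 ^ g.cat), single_nonneg.2 h0, ?_, fun v => ?_⟩
  · rw [norm1_eq_linearCombination (single_nonneg.2 h0), linearCombination_single, smul_eq_mul,
      mul_one, div_le_iff₀ (by positivity), mul_comm]
    exact hK
  · rw [coverage_single]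
    simp only [P, Multiset.count_replicate]
    split_ifs
    · push_cast
      field_simp
    · simp

open scoped Classical in
/-- Shifting: a strip packing of the items yields a fractional packing of the rounded containers.
Each item is replaced by containers of the next group, and the containers of the leading groups
are packed separately. -/
lemma Invariant.intOpt_le_of_isPacking (hR : Invariant I con R) (hε : 0 < ε) (hε4 : ε ≤ 1 / 4)
    (hsize : 4 * numCategories ε * containerHeight ε / ε * (containerHeight ε + 1) ≤ I.size)
    {H : ℝ} {p : ι → ℝ × ℝ} (hH : 0 ≤ H) (hp : I.IsPacking H p) :
    intOpt (roundedInstance I con R) ≤ (1 + 4 * ε) * (H / containerHeight ε) + 36 / ε ^ 4 := by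
  have hB := le_containerHeight hε hε4
  obtain ⟨-, hk, hωk, -⟩ := blockParam_bounds hε hε4 hsize
  have hw : ∀ i, 0 ≤ I.w i := fun i => hε.le.trans (I.le_w i)
  obtain ⟨μ, hμ0, hμH, hμh, hμw⟩ := hp.exists_slices hε hH
  obtain ⟨x₁, hx₁, hx₁n, hx₁c⟩ := exists_coverage_of_slices (C := roundedInstance I con R)
    (c := (1 + ε) / containerHeight ε) (by positivity) hw hμ0 hμh hμw
    ((usedGroups con R).filter fun g => ¬ IsLeading g)
    (fun g => Finset.univ.filter fun i => R (con i) = g.prev)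
    (fun g hg g' hg' hne => Finset.disjoint_left.2 fun i hi hi' => hne
      (prev_injOn (Finset.mem_filter.1 hg).2 (Finset.mem_filter.1 hg').2
        ((Finset.mem_filter.1 hi).2.symm.trans (Finset.mem_filter.1 hi').2)))
    (groupWidth I con R)
    (fun g hg => mem_roundedInstance.2 (by
      obtain ⟨i, hi⟩ := mem_usedGroups.1 (Finset.mem_filter.1 hg).1
      exact ⟨i, by rw [hi]⟩))
    (fun g hg i hi => groupWidth_le (hw i) fun j hj => hR.sorting i j (by
      rw [(Finset.mem_filter.1 hi).2, hj]
      exact isLeftOf_prev (Finset.mem_filter.1 hg).2))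
  have hlead : ∀ g ∈ (usedGroups con R).filter IsLeading,
      ∃ x : Pattern (roundedInstance I con R) →₀ ℝ, 0 ≤ x ∧ norm1 x ≤ blockParam I ∧
        ∀ v, coverage x v = if groupWidth I con R g = v then (groupCard R g : ℝ) else 0 := by
    intro g hg
    rw [Finset.mem_filter, mem_usedGroups] at hg
    obtain ⟨⟨i, rfl⟩, hg⟩ := hg
    exact hR.exists_coverage_of_isLeading hg
  choose! f hf0 hfn hfc using hlead
  have hx₂ : 0 ≤ ∑ g ∈ (usedGroups con R).filter IsLeading, f g := Finset.sum_nonneg hf0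
  have hx₂n : norm1 (∑ g ∈ (usedGroups con R).filter IsLeading, f g) ≤
      3 * (numCategories ε * (blockParam I : ℝ)) := by
    refine (Finset.le_sum_of_subadditive norm1 norm1_zero.le norm1_add_le _ _).trans
      ((Finset.sum_le_card_nsmul _ _ _ hfn).trans ?_)
    have h1 : (((usedGroups con R).filter IsLeading).card : ℝ) ≤ 3 * numCategories ε := by
      exact_mod_cast (hR.card_usedGroups_le hε hε4 hsize).1
    rw [nsmul_eq_mul, ← mul_assoc]
    gcongr
  have hsol : IsSolution (roundedInstance I con R)
      (x₁ + ∑ g ∈ (usedGroups con R).filter IsLeading, f g) := by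
    refine ⟨add_nonneg hx₁ hx₂, fun v _ => (demand_roundedInstance_le v).trans ?_⟩
    rw [coverage_add, coverage_sum, hx₁c, Finset.sum_congr rfl fun g hg => hfc g hg v,
      ← Finset.sum_filter, ← Finset.sum_filter_not_add_sum_filter _ IsLeading]
    simp only [Finset.filter_filter, and_comm]
    refine add_le_add (Finset.sum_le_sum fun g hg => ?_) le_rfl
    rw [Finset.mem_filter, mem_usedGroups] at hg
    obtain ⟨⟨i, rfl⟩, hg⟩ := hg
    have hg' : ¬ IsLeading (R (con i)) := by tauto
    exact hR.groupCard_le_groupHeight_prev hε hε4 hk hg'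
  have h1 := intOpt_le_norm1_add hsol
  have h2 := hR.numConstraints_add_one_le hε hε4 hsize
  rw [norm1_add hx₁ hx₂, hx₁n, hμH] at h1
  have h3 : ε * I.size / (4 * containerHeight ε) ≤ ε * (H / containerHeight ε) := by
    rw [mul_div_assoc']
    have : 0 ≤ ε * H := by positivity
    have h5 : ε * I.size ≤ ε * H := by gcongr; exact hp.size_le hε hH
    gcongr
    linarith
  have h4 : (1 + ε) / containerHeight ε * H = (1 + ε) * (H / containerHeight ε) := by ring
  linarith

/-- The rounding costs a factor of `1 + 4 ε` and an additive constant. -/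
theorem Invariant.intOpt_le_opt (hR : Invariant I con R) (hε : 0 < ε) (hε4 : ε ≤ 1 / 4)
    (hsize : 4 * numCategories ε * containerHeight ε / ε * (containerHeight ε + 1) ≤ I.size) :
    intOpt (roundedInstance I con R) ≤
      (1 + 4 * ε) * (I.opt / containerHeight ε) + 36 / ε ^ 4 := by
  have hB : 0 < containerHeight ε := by linarith [le_containerHeight hε hε4]
  have h : (intOpt (roundedInstance I con R) - 36 / ε ^ 4) / ((1 + 4 * ε) / containerHeight ε) ≤
      I.opt := by
    refine le_csInf I.exists_isPacking ?_
    rintro H ⟨hH, p, hp⟩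
    rw [div_le_iff₀ (by positivity)]
    have := hR.intOpt_le_of_isPacking hε hε4 hsize hH hp
    have heq : H * ((1 + 4 * ε) / containerHeight ε) = (1 + 4 * ε) * (H / containerHeight ε) := by
      ring
    linarith
  rw [div_le_iff₀ (by positivity)] at h
  have heq : I.opt * ((1 + 4 * ε) / containerHeight ε) =
      (1 + 4 * ε) * (I.opt / containerHeight ε) := by ring
  linarith

end Rounding

end StripPacking

theorem mainTheorem6 :
    ∃ C₀ C₁ : ℝ, 0 < C₀ ∧ 0 < C₁ ∧
    ∀ (ε : ℝ), 0 < ε → ε ≤ 1 / 4 → (∃ N : ℕ, 1 / ε = N) →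
    ∀ (ι κ : Type*) [Fintype ι] [Fintype κ]
      (I : StripPacking.LargeInstance ε ι) (con : ι → κ) (R : κ → StripPacking.WidthGroup),
    StripPacking.IsContainerAssignment I con →
    StripPacking.Invariant I con R →
    4 * StripPacking.numCategories ε * StripPacking.containerHeight ε / ε *
      (StripPacking.containerHeight ε + 1) ≤ I.size →
    ∀ (C : Multiset ℝ) (m : ℕ) (u opt : ℝ),
    C = StripPacking.roundedInstance I con R →
    m = StripPacking.numConstraints C →
    -- the unit in which the height of packings of the items is measured
    (u = 1 ∨ u = StripPacking.containerHeight ε) →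
    opt = I.opt / u →
    StripPacking.intOpt C ≤ (1 + 4 * ε) * opt + C₀ / ε ^ 4 ∧
    ∀ (z δ δ' Δ D : ℝ) (α : ℕ)
      (x : StripPacking.Pattern C →₀ ℝ) (y : StripPacking.Pattern C →₀ ℕ),
    C₀ / ε ^ 4 ≤ z →
    0 < δ →
    0 < δ' →
    Δ = (1 + 4 * ε) * (1 + δ) - 1 →
    D = Δ * opt + m + (1 + δ) * z →
    StripPacking.IsSolution C x →
    StripPacking.norm1 x ≤ (1 + Δ) * opt + (1 + δ) * z →
    2 * α * (1 / δ + 1) ≤ StripPacking.norm1 x →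
    StripPacking.norm1 x = (1 + δ') * StripPacking.lin C →
    StripPacking.IsSolution C (StripPacking.toReal y) →
    (m + 2) * (1 / δ + 2) ≤ StripPacking.norm1 (StripPacking.toReal y) →
    StripPacking.norm1 (StripPacking.toReal y) ≤ (1 + 2 * Δ) * opt + 2 * (1 + δ) * z + m →
    StripPacking.nnz x = StripPacking.nnz y →
    (StripPacking.nnz y : ℝ) ≤ D →
    (∀ P, x P ≤ y P) →
    (∃ x' y', StripPacking.IsImproveOutput C δ α x y x' y') ∧
    ∀ x' y', StripPacking.IsImproveOutput C δ α x y x' y' →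
      StripPacking.IsSolution C x' ∧
      StripPacking.norm1 x' ≤ (1 + Δ) * opt + (1 + δ) * z - α ∧
      StripPacking.IsSolution C (StripPacking.toReal y') ∧
      StripPacking.norm1 (StripPacking.toReal y') ≤
        (1 + 2 * Δ) * opt + 2 * (1 + δ) * z + m - α ∧
      StripPacking.nnz x' = StripPacking.nnz y' ∧
      (StripPacking.nnz y' : ℝ) ≤ D ∧
      (∀ P, x' P ≤ y' P) ∧
      StripPacking.levelsChanged y y' ≤ C₁ * ((m + α) * (1 + 1 / δ)) := by
  refine ⟨36, 29, by norm_num, by norm_num, ?_⟩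
  intro ε hε hε4 _ ι κ _ _ I con R _ hR hsize C m u opt hC hm hu hopt
  subst hC
  have hB := StripPacking.le_containerHeight hε hε4
  have hopt0 : 0 ≤ opt := by
    rw [hopt]
    refine div_nonneg I.opt_nonneg ?_
    rcases hu with rfl | rfl <;> linarith
  have hround : StripPacking.intOpt (StripPacking.roundedInstance I con R) ≤
      (1 + 4 * ε) * opt + 36 / ε ^ 4 := by
    refine (hR.intOpt_le_opt hε hε4 hsize).trans ?_
    -- the unit `1` gives the weaker bound
    have : I.opt / StripPacking.containerHeight ε ≤ opt := by
      rw [hopt]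
      refine div_le_div_of_nonneg_left I.opt_nonneg ?_ ?_ <;> rcases hu with rfl | rfl <;> linarith
    gcongr
  refine ⟨hround, ?_⟩
  intro z δ δ' Δ D α x y hz hδ _ hΔ hD hx hxT hα _ hy _ hyM hnnz hyD hxy
  have hwidth : ∀ w ∈ StripPacking.roundedInstance I con R, ε ≤ w := by
    intro w hw
    obtain ⟨i, rfl⟩ := StripPacking.mem_roundedInstance.1 hw
    exact (I.le_w i).trans (StripPacking.le_groupWidth i)
  have := StripPacking.finite_pattern hε hwidth
  refine ⟨StripPacking.exists_isImproveOutput hδ hα hx hxy, ?_⟩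
  intro x' y' hout
  have hm1 : 1 ≤ StripPacking.numConstraints (StripPacking.roundedInstance I con R) := by
    have hpos := (StripPacking.blockParam_bounds hε hε4 hsize).1
    obtain ⟨i⟩ : Nonempty ι := by
      by_contra h
      rw [not_nonempty_iff] at h
      simp [StripPacking.LargeInstance.size] at hpos
    exact Finset.card_pos.2
      ⟨_, Multiset.mem_toFinset.2 (StripPacking.mem_roundedInstance.2 ⟨i, rfl⟩)⟩
  have hm0 : (0 : ℝ) ≤ m := Nat.cast_nonneg m
  have hC₀ : 1 ≤ 36 / ε ^ 4 := by
    have : ε ^ 4 ≤ 1 := pow_le_one₀ hε.le (by linarith)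
    rw [le_div_iff₀ (by positivity)]
    linarith
  have hz1 : 1 ≤ z := hC₀.trans hz
  have hΔδ : δ ≤ Δ := by rw [hΔ]; nlinarith
  have hzδ : 0 ≤ δ * z := by positivity
  have hΔopt : 0 ≤ Δ * opt := mul_nonneg (hδ.le.trans hΔδ) hopt0
  have hlin : (1 + δ) * StripPacking.lin (StripPacking.roundedInstance I con R) ≤
      (1 + Δ) * opt + (1 + δ) * z := by
    have h1 : StripPacking.lin (StripPacking.roundedInstance I con R) ≤
        (1 + 4 * ε) * opt + z := by
      linarith [StripPacking.lin_le_intOpt hy]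
    calc _ ≤ (1 + δ) * ((1 + 4 * ε) * opt + z) := by gcongr
      _ = (1 + Δ) * opt + (1 + δ) * z := by rw [hΔ]; ring
  have hMD : (1 + 2 * Δ) * opt + 2 * (1 + δ) * z + m ≤ (1 / δ + 2) * D := by
    have h1 : opt ≤ 1 / δ * (Δ * opt) := by
      rw [← mul_assoc, one_div_mul_eq_div]
      exact le_mul_of_one_le_left hopt0 ((one_le_div hδ).2 hΔδ)
    have h2 : 0 ≤ 1 / δ * (m + (1 + δ) * z) := by positivity
    rw [hD]
    linarith
  have hspec := hout.spec hδ hα hx hxT hlin hxy hnnz hyD hm1 (by rw [← hm, hD]; linarith)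
    (by rw [← StripPacking.norm1_toReal]; exact hyM) hMD (by rw [hD]; linarith)
  rwa [← hm] at hspec
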